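/- Let $G$ be a finite simple graph. A $2$-rainbow function for $G$ is a function $f:V(G)\to 2^{\{1,2\}}$ such that for every vertex $x$ with $f(x)=\varnothing$ we have $\bigcup_{y\in N(x)} f(y)=\{1,2\}$. The $2$-rainbow domination number $\gamma_{r2}(G)$ is the minimum of $\sum_{x\in V(G)}|f(x)|$ over all $2$-rainbow functions $f$ for $G$. An interval graph is the intersection graph of a family of intervals of the real line. Theorem. There is a polynomial-time algorithm that computes the $2$-rainbow domination number of interval graphs. More precisely, there are a program for a random access machine (whose unit-cost instructions are: loading a constant, addition, truncated subtraction, indirect load and store, reading an input cell, and conditional jump) and a constant $C$ such that for every $n\ge 0$ and every interval graph $G$ with vertex set $\{0,\dots,n-1\}$, the program, given $n$ and the adjacency matrix of $G$ as input, halts after at most $C(n+1)^9$ steps with output $\gamma_{r2}(G)$; so the running time is $O(n^9)$. -/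

import Mathlib

/-! ### Interval graphs and rainbow domination -/

/-- `G` is an interval graph: it is the intersection graph of a family of (nonempty, closed,
bounded) intervals of the real line. -/
def IsIntervalGraph {V : Type*} (G : SimpleGraph V) : Prop :=
  ∃ l r : V → ℝ, (∀ v, l v ≤ r v) ∧
    ∀ u v, u ≠ v → (G.Adj u v ↔ (Set.Icc (l u) (r u) ∩ Set.Icc (l v) (r v)).Nonempty)

/-- `f : V → 2^[k]` is a `k`-rainbow function for `G`: whenever `f x = ∅`, the labels of the
neighbours of `x` together contain all `k` colors. -/
def IsRainbowFunction {V : Type*} (k : ℕ) (G : SimpleGraph V) (f : V → Finset (Fin k)) : Prop :=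
  ∀ x, f x = ∅ → ∀ c : Fin k, ∃ y, G.Adj x y ∧ c ∈ f y

/-- The cost `‖f‖ = ∑ x, |f x|`. -/
def rainbowCost {V : Type*} [Fintype V] {k : ℕ} (f : V → Finset (Fin k)) : ℕ :=
  ∑ x, (f x).card

/-- The `k`-rainbow domination number of `G`: the minimum cost of a `k`-rainbow function. -/
noncomputable def rainbowDominationNumber {V : Type*} [Fintype V] (k : ℕ) (G : SimpleGraph V) :
    ℕ :=
  sInf {c | ∃ f : V → Finset (Fin k), IsRainbowFunction k G f ∧ rainbowCost f = c}

/-- The minimum in the definition of the `k`-rainbow domination number is attained. -/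
theorem exists_rainbowFunction_cost_eq {V : Type*} [Fintype V] (k : ℕ) (G : SimpleGraph V) :
    ∃ f : V → Finset (Fin k),
      IsRainbowFunction k G f ∧ rainbowCost f = rainbowDominationNumber k G := by
  refine Nat.sInf_mem (s := {c | ∃ f : V → Finset (Fin k),
    IsRainbowFunction k G f ∧ rainbowCost f = c}) ⟨_, fun _ => Finset.univ, ?_, rfl⟩
  intro x hx c
  exact absurd (Finset.mem_univ c) (by simp [hx])

/-! ### Random access machines -/

/-- Instructions of a random access machine. `R i` is the content of register `i` and `w` is the
read-only input word. There is no multiplication, so that in `t` steps register contents grow by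
at most `t` bits, and unit-cost polynomial time is polynomial time on a Turing machine. -/
inductive RAMInstr : Type
  /-- `R i := c` -/
  | const (i c : ℕ)
  /-- `R i := R j + R k` -/
  | add (i j k : ℕ)
  /-- `R i := R j - R k`, truncated at `0` -/
  | sub (i j k : ℕ)
  /-- `R i := R (R j)` -/
  | load (i j : ℕ)
  /-- `R (R i) := R j` -/
  | store (i j : ℕ)
  /-- `R i :=` the letter of the input word at position `R j` (`0` beyond the end of the word) -/
  | read (i j : ℕ)
  /-- if `R i = 0`, continue with the instruction number `m` -/
  | jumpZero (i m : ℕ)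

/-- A program is a finite list of instructions, numbered from `0`. -/
abbrev RAMProgram : Type := List RAMInstr

/-- A configuration: the program counter and the contents of the registers. -/
structure RAMConfig : Type where
  pc : ℕ
  reg : ℕ → ℕ

namespace RAMProgram

/-- At the start the program counter and all registers are `0`. -/
def init : RAMConfig := ⟨0, fun _ => 0⟩

/-- The effect of one instruction on input word `w`. -/
def exec (w : List ℕ) (c : RAMConfig) : RAMInstr → RAMConfig
  | .const i a => ⟨c.pc + 1, Function.update c.reg i a⟩
  | .add i j k => ⟨c.pc + 1, Function.update c.reg i (c.reg j + c.reg k)⟩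
  | .sub i j k => ⟨c.pc + 1, Function.update c.reg i (c.reg j - c.reg k)⟩
  | .load i j => ⟨c.pc + 1, Function.update c.reg i (c.reg (c.reg j))⟩
  | .store i j => ⟨c.pc + 1, Function.update c.reg (c.reg i) (c.reg j)⟩
  | .read i j => ⟨c.pc + 1, Function.update c.reg i (w.getD (c.reg j) 0)⟩
  | .jumpZero i m => ⟨if c.reg i = 0 then m else c.pc + 1, c.reg⟩

/-- One computation step of unit cost; when the program counter has left the program, the machine
has halted and the configuration no longer changes. -/
def step (P : RAMProgram) (w : List ℕ) (c : RAMConfig) : RAMConfig :=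
  match P[c.pc]? with
  | some a => exec w c a
  | none => c

/-- The machine has halted: the program counter is outside the program. -/
def Halted (P : RAMProgram) (c : RAMConfig) : Prop := P.length ≤ c.pc

/-- On input word `w`, the program `P` halts after at most `t` steps, with output `out` in
register `0`. -/
def OutputsWithin (P : RAMProgram) (w : List ℕ) (out t : ℕ) : Prop :=
  P.Halted ((P.step w)^[t] init) ∧ ((P.step w)^[t] init).reg 0 = out

end RAMProgram

open Classical in
/-- The encoding of a graph with vertices `0, …, n - 1` as an input word: the number `n`, followed
by the `n * n` entries (`0` or `1`) of the adjacency matrix, row by row. -/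
noncomputable def encodeGraph {n : ℕ} (G : SimpleGraph (Fin n)) : List ℕ :=
  n :: List.ofFn fun p : Fin (n * n) => if G.Adj p.divNat p.modNat then 1 else 0

/-! ### A small loop language with tables, and its compilation to random access machines -/

/-! The input contains only the adjacency matrix, so the machine must first find an interval model
and then optimize over it.

Interval model. Disjointness of intervals orients every nonadjacent pair. If `a` precedes `b`, `b`
is adjacent to `c`, and `a` is not adjacent to `c`, then `a` precedes `c`, and dually. This forcing
relation splits the oriented nonadjacent pairs into classes, and the true interval order contains
each class entirely or contains all of its reversed pairs. No class therefore contains both a pair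
and its reverse. The true order is unknown, so classes are oriented greedily: pairs are visited
lexicographically, and an unoriented one is oriented together with all it forces. Because the first
entry of the chosen pair is the smallest vertex in its class, no directed triangle arises
(`IsPartialOrientation.not_triangle`), so the final orientation is transitive. Absence of induced
4-cycles makes the sets of predecessors nested (`IsPartialOrientation.pred_total`); counting
predecessors then gives integer endpoints below `n` (`IsPartialOrientation.isIntervalModel`).

Optimization. Vertices are swept by decreasing right end. An earlier vertex `y` then meets the
current `x` exactly when `l y ≤ r x`. For each color it thus suffices to know the least left end
among vertices of that color and the greatest left end among vertices still lacking it
(`ColorState.Describes.next`). Two colors give about `n ^ 4` states, and a table of least completion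
costs over all states is updated once per vertex (`dpStmt_spec`). Unserved vertices incur a final
penalty larger than `2 * n`, so an optimum never pays it.

Running time. The algorithm is written in a loop language whose loops all have length `N = n + 1`.
Its compilation to the machine is proved correct by structural induction, and its cost is polynomial
of degree the nesting depth, so the time bound reduces to evaluating a depth. -/

/-- Expressions. `var x` is the variable bound by the `x`-th enclosing loop, `len` is the common
length `N` of all loops, `tab k a` is entry `a` of table `k`, `mulN a` is `a * N`, and `sum e` is
the sum of `e` over the values `0, …, N - 1` of a new variable. -/
inductive Ex : Type
  | num (c : ℕ)
  | var (x : ℕ)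
  | len
  | add (a b : Ex)
  | sub (a b : Ex)
  | inp (a : Ex)
  | tab (k : Fin 8) (a : Ex)
  | ite (c a b : Ex)
  | mulN (a : Ex)
  | sum (e : Ex)

/-- Statements: assignment to a table entry, composition, and a loop in which a new variable runs
through `0, …, N - 1`. -/
inductive Stmt : Type
  | store (k : Fin 8) (a e : Ex)
  | seq (s t : Stmt)
  | loop (s : Stmt)

/-- The contents of the eight tables. -/
abbrev Tables : Type := Fin 8 → ℕ → ℕ

/-- Apply `F 0`, …, `F (k - 1)` in turn. -/
def iter {α : Type*} (F : ℕ → α → α) : ℕ → α → α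
  | 0, x => x
  | k + 1, x => F k (iter F k x)

/-- The value of an expression below `v` loops. -/
def Ex.eval (w : List ℕ) (N : ℕ) (T : Tables) : Ex → ℕ → (ℕ → ℕ) → ℕ
  | .num c, _, _ => c
  | .var x, v, ρ => if x < v then ρ x else 0
  | .len, _, _ => N
  | .add a b, v, ρ => a.eval w N T v ρ + b.eval w N T v ρ
  | .sub a b, v, ρ => a.eval w N T v ρ - b.eval w N T v ρ
  | .inp a, v, ρ => w.getD (a.eval w N T v ρ) 0
  | .tab k a, v, ρ => T k (a.eval w N T v ρ)
  | .ite c a b, v, ρ => if c.eval w N T v ρ = 0 then b.eval w N T v ρ else a.eval w N T v ρ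
  | .mulN a, v, ρ => a.eval w N T v ρ * N
  | .sum e, v, ρ => ∑ i ∈ Finset.range N, e.eval w N T (v + 1) (Function.update ρ v i)

/-- The effect of a statement on the tables. -/
def Stmt.exec (w : List ℕ) (N : ℕ) : Stmt → ℕ → (ℕ → ℕ) → Tables → Tables
  | .store k a e, v, ρ, T =>
      Function.update T k (Function.update (T k) (a.eval w N T v ρ) (e.eval w N T v ρ))
  | .seq s t, v, ρ, T => t.exec w N v ρ (s.exec w N v ρ T)
  | .loop s, v, ρ, T => iter (fun i => s.exec w N (v + 1) (Function.update ρ v i)) N T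

/-- A bound for the number of machine steps taken by an expression. -/
def Ex.cost (N : ℕ) : Ex → ℕ
  | .num _ => 1
  | .var _ => 1
  | .len => 1
  | .add a b => a.cost N + b.cost N + 1
  | .sub a b => a.cost N + b.cost N + 1
  | .inp a => a.cost N + 1
  | .tab _ a => a.cost N + 7
  | .ite c a b => c.cost N + a.cost N + b.cost N + 2
  | .mulN a => a.cost N + (3 + N * 4)
  | .sum e => 4 + N * (e.cost N + 5)

/-- A bound for the number of machine steps taken by a statement. -/
def Stmt.cost (N : ℕ) : Stmt → ℕ
  | .store _ a e => a.cost N + e.cost N + 7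
  | .seq s t => s.cost N + t.cost N
  | .loop s => 3 + N * (s.cost N + 4)

/-- The nesting depth of the loops in an expression. -/
def Ex.depth : Ex → ℕ
  | .num _ => 0
  | .var _ => 0
  | .len => 0
  | .add a b => max a.depth b.depth
  | .sub a b => max a.depth b.depth
  | .inp a => a.depth
  | .tab _ a => a.depth
  | .ite c a b => max c.depth (max a.depth b.depth)
  | .mulN a => max a.depth 1
  | .sum e => e.depth + 1

/-- The nesting depth of the loops in a statement. -/
def Stmt.depth : Stmt → ℕ
  | .store _ a e => max a.depth e.depth
  | .seq s t => max s.depth t.depth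
  | .loop s => s.depth + 1

/-! ### Cost is polynomial of degree the nesting depth -/

/-- `a N = O(N ^ d)` for `N ≥ 1`. -/
def PolyBound (a : ℕ → ℕ) (d : ℕ) : Prop := ∃ C, ∀ N, 1 ≤ N → a N ≤ C * N ^ d

theorem PolyBound.const (k d : ℕ) : PolyBound (fun _ => k) d :=
  ⟨k, fun _ hN => Nat.le_mul_of_pos_right k (Nat.pow_pos hN)⟩

theorem PolyBound.mono {a : ℕ → ℕ} {d d' : ℕ} (h : PolyBound a d) (hd : d ≤ d') :
    PolyBound a d' := by
  obtain ⟨C, h⟩ := h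
  exact ⟨C, fun N hN => (h N hN).trans (Nat.mul_le_mul_left C (Nat.pow_le_pow_right hN hd))⟩

theorem PolyBound.add {a b : ℕ → ℕ} {d : ℕ} (ha : PolyBound a d) (hb : PolyBound b d) :
    PolyBound (fun N => a N + b N) d := by
  obtain ⟨C, ha⟩ := ha
  obtain ⟨C', hb⟩ := hb
  exact ⟨C + C', fun N hN => by rw [add_mul]; exact add_le_add (ha N hN) (hb N hN)⟩

theorem PolyBound.mul_left {a : ℕ → ℕ} {d : ℕ} (ha : PolyBound a d) :
    PolyBound (fun N => N * a N) (d + 1) := by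
  obtain ⟨C, ha⟩ := ha
  exact ⟨C, fun N hN => (Nat.mul_le_mul_left N (ha N hN)).trans (by rw [pow_succ]; ring_nf; rfl)⟩

/-- Only loops multiply the cost by `N`. A multiplication by `N` is itself a loop of repeated
additions, but it runs after its operand has been evaluated, so nested multiplications add their
costs and the depth stays at 1. -/
theorem Ex.polyBound_cost (e : Ex) : PolyBound (fun N => e.cost N) e.depth := by
  induction e with
  | num c => exact .const _ _
  | var x => exact .const _ _
  | len => exact .const _ _
  | add a b ha hb =>
    exact ((ha.mono (le_max_left _ _)).add (hb.mono (le_max_right _ _))).add (.const _ _)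
  | sub a b ha hb =>
    exact ((ha.mono (le_max_left _ _)).add (hb.mono (le_max_right _ _))).add (.const _ _)
  | inp a ha => exact ha.add (.const _ _)
  | tab k a ha => exact ha.add (.const _ _)
  | ite c a b hc ha hb =>
    exact (((hc.mono (le_max_left _ _)).add (ha.mono ((le_max_left _ _).trans
      (le_max_right _ _)))).add (hb.mono ((le_max_right _ _).trans (le_max_right _ _)))).add
      (.const _ _)
  | mulN a ha =>
    exact (ha.mono (le_max_left _ _)).add ((PolyBound.const _ _).add
      ((PolyBound.const 4 0).mul_left.mono (le_max_right _ _)))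
  | sum e he => exact (PolyBound.const _ _).add (he.add (.const _ _)).mul_left

theorem Stmt.polyBound_cost (s : Stmt) : PolyBound (fun N => s.cost N) s.depth := by
  induction s with
  | store k a e =>
    exact ((a.polyBound_cost.mono (le_max_left _ _)).add
      (e.polyBound_cost.mono (le_max_right _ _))).add (.const _ _)
  | seq s t hs ht => exact (hs.mono (le_max_left _ _)).add (ht.mono (le_max_right _ _))
  | loop s hs => exact (PolyBound.const _ _).add (hs.add (.const _ _)).mul_left

/-! ### Register layout and generated code -/

/-- The register of variable `x`. -/
def vr (x : ℕ) : ℕ := 16 * x + 1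

/-- The temporary register number `t`. -/
def tm (t : ℕ) : ℕ := 16 * t + 2

/-- The register of entry `i` of table `k`. -/
def tb (k : Fin 8) (i : ℕ) : ℕ := 16 * i + (8 + k)

/-- Double register `tm t` four times, add `8 + k`: the address of a table entry. -/
def addrCode (k : Fin 8) (t : ℕ) : List RAMInstr :=
  [.add (tm t) (tm t) (tm t), .add (tm t) (tm t) (tm t), .add (tm t) (tm t) (tm t),
    .add (tm t) (tm t) (tm t), .const (tm (t + 1)) (8 + k), .add (tm t) (tm t) (tm (t + 1))]

/-- Code for an expression below `v` loops, with temporaries from `t` on, placed at position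
`off`. The value is put in register `tm t`. Registers `3`, `4`, `5` hold `0`, `N`, `1`. -/
def Ex.code : Ex → ℕ → ℕ → ℕ → List RAMInstr
  | .num c, _, t, _ => [.const (tm t) c]
  | .var x, v, t, _ => if x < v then [.add (tm t) (vr x) 3] else [.const (tm t) 0]
  | .len, _, t, _ => [.add (tm t) 4 3]
  | .add a b, v, t, off =>
    let ca := a.code v t off
    ca ++ b.code v (t + 1) (off + ca.length) ++ [.add (tm t) (tm t) (tm (t + 1))]
  | .sub a b, v, t, off =>
    let ca := a.code v t off
    ca ++ b.code v (t + 1) (off + ca.length) ++ [.sub (tm t) (tm t) (tm (t + 1))]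
  | .inp a, v, t, off => a.code v t off ++ [.read (tm t) (tm t)]
  | .tab k a, v, t, off => a.code v t off ++ (addrCode k t ++ [.load (tm t) (tm t)])
  | .ite c a b, v, t, off =>
    let cc := c.code v t off
    let ca := a.code v t (off + cc.length + 1)
    let o := off + cc.length + 1 + ca.length + 1
    let cb := b.code v t o
    cc ++ ([.jumpZero (tm t) o] ++ (ca ++ ([.jumpZero 3 (o + cb.length)] ++ cb)))
  | .mulN a, v, t, off =>
    let ca := a.code v (t + 2) off
    let o := off + ca.length + 2
    ca ++ ([.const (tm t) 0, .add (tm (t + 1)) 4 3] ++ [.jumpZero (tm (t + 1)) (o + 4),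
      .add (tm t) (tm t) (tm (t + 2)), .sub (tm (t + 1)) (tm (t + 1)) 5, .jumpZero 3 o])
  | .sum e, v, t, off =>
    let ce := e.code (v + 1) (t + 2) (off + 4)
    [.const (tm t) 0, .const (vr v) 0, .add (tm (t + 1)) 4 3] ++
      ([.jumpZero (tm (t + 1)) (off + 4 + ce.length + 4)] ++ (ce ++
      [.add (tm t) (tm t) (tm (t + 2)), .add (vr v) (vr v) 5, .sub (tm (t + 1)) (tm (t + 1)) 5,
        .jumpZero 3 (off + 3)]))

/-- Code for a statement below `v` loops, with temporaries from `t` on, placed at `off`. -/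
def Stmt.code : Stmt → ℕ → ℕ → ℕ → List RAMInstr
  | .store k a e, v, t, off =>
    let ca := a.code v t off ++ addrCode k t
    ca ++ (e.code v (t + 1) (off + ca.length) ++ [.store (tm t) (tm (t + 1))])
  | .seq s s', v, t, off =>
    let cs := s.code v t off
    cs ++ s'.code v t (off + cs.length)
  | .loop s, v, t, off =>
    let cs := s.code (v + 1) (t + 1) (off + 3)
    [.const (vr v) 0, .add (tm t) 4 3] ++
      ([.jumpZero (tm t) (off + 3 + cs.length + 3)] ++ (cs ++
      [.add (vr v) (vr v) 5, .sub (tm t) (tm t) 5, .jumpZero 3 (off + 2)]))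

/-! ### Bounded reachability between configurations -/

/-- `c'` is reached from `c` after at most `k` steps. -/
def Reach (P : RAMProgram) (w : List ℕ) (k : ℕ) (c c' : RAMConfig) : Prop :=
  ∃ s ≤ k, (P.step w)^[s] c = c'

theorem Reach.refl (P : RAMProgram) (w : List ℕ) (k : ℕ) (c : RAMConfig) : Reach P w k c c :=
  ⟨0, Nat.zero_le _, rfl⟩

theorem Reach.trans {P : RAMProgram} {w : List ℕ} {k k' : ℕ} {c c' c'' : RAMConfig}
    (h : Reach P w k c c') (h' : Reach P w k' c' c'') : Reach P w (k + k') c c'' := by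
  obtain ⟨s, hs, rfl⟩ := h
  obtain ⟨s', hs', rfl⟩ := h'
  exact ⟨s' + s, by omega, Function.iterate_add_apply _ _ _ _⟩

theorem Reach.mono {P : RAMProgram} {w : List ℕ} {k k' : ℕ} {c c' : RAMConfig}
    (h : Reach P w k c c') (hk : k ≤ k') : Reach P w k' c c' :=
  h.imp fun _ ⟨h1, h2⟩ => ⟨h1.trans hk, h2⟩

/-- The list `l` stands at position `off` of the program `P`. -/
def CodeAt (P : RAMProgram) (off : ℕ) (l : List RAMInstr) : Prop :=
  ∃ pre post, P = pre ++ l ++ post ∧ pre.length = off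

theorem CodeAt.left {P : RAMProgram} {off : ℕ} {l l' : List RAMInstr}
    (h : CodeAt P off (l ++ l')) : CodeAt P off l := by
  obtain ⟨p, q, rfl, hp⟩ := h
  exact ⟨p, l' ++ q, by simp, hp⟩

theorem CodeAt.right {P : RAMProgram} {off : ℕ} {l l' : List RAMInstr}
    (h : CodeAt P off (l ++ l')) : CodeAt P (off + l.length) l' := by
  obtain ⟨p, q, rfl, hp⟩ := h
  exact ⟨p ++ l, q, by simp, by simp [hp]⟩

theorem CodeAt.tail {P : RAMProgram} {off : ℕ} {a : RAMInstr} {l : List RAMInstr}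
    (h : CodeAt P off (a :: l)) : CodeAt P (off + 1) l :=
  CodeAt.right (l := [a]) h

theorem CodeAt.reach {P : RAMProgram} {off : ℕ} {a : RAMInstr} {l : List RAMInstr}
    (h : CodeAt P off (a :: l)) (w : List ℕ) (r : ℕ → ℕ) :
    Reach P w 1 ⟨off, r⟩ (RAMProgram.exec w ⟨off, r⟩ a) := by
  obtain ⟨p, q, rfl, rfl⟩ := h
  refine ⟨1, le_rfl, ?_⟩
  simp [RAMProgram.step]

/-- The effect of an instruction other than a jump on the registers. -/
def effect (w : List ℕ) (r : ℕ → ℕ) (a : RAMInstr) : ℕ → ℕ := (RAMProgram.exec w ⟨0, r⟩ a).reg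

/-- The instruction is not a jump. -/
def RAMInstr.Straight : RAMInstr → Prop
  | .jumpZero _ _ => False
  | _ => True

theorem CodeAt.reach_straight {P : RAMProgram} (w : List ℕ) (l : List RAMInstr) (off : ℕ)
    (r : ℕ → ℕ) (h : CodeAt P off l) (hl : ∀ a ∈ l, a.Straight) :
    Reach P w l.length ⟨off, r⟩ ⟨off + l.length, l.foldl (effect w) r⟩ := by
  induction l generalizing off r with
  | nil => exact Reach.refl _ _ _ _
  | cons a l ih =>
    have h1 := h.reach w r
    have e : RAMProgram.exec w ⟨off, r⟩ a = ⟨off + 1, effect w r a⟩ := by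
      have := hl a (by simp)
      cases a <;> first | rfl | exact this.elim
    rw [e] at h1
    have h2 := ih (off + 1) (effect w r a) h.tail (fun b hb => hl b (by simp [hb]))
    have := h1.trans h2
    rw [List.length_cons, List.foldl_cons, add_comm l.length, ← add_assoc off]
    exact this

/-! ### Register invariants and correctness of expression code -/

/-- The constants `0`, `N`, `1` are in their registers. -/
def HasConsts (N : ℕ) (r : ℕ → ℕ) : Prop := r 3 = 0 ∧ r 4 = N ∧ r 5 = 1

/-- `r'` agrees with `r` except at variables from `v` on and at temporaries from `t` on. -/
def Agree (v t : ℕ) (r r' : ℕ → ℕ) : Prop :=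
  ∀ a, (a % 16 = 1 → a < vr v) → (a % 16 = 2 → a < tm t) → r' a = r a

theorem Agree.trans {v t v' t' : ℕ} {r r' r'' : ℕ → ℕ} (h : Agree v t r r')
    (h' : Agree v' t' r' r'') (hv : v ≤ v') (ht : t ≤ t') : Agree v t r r'' := by
  intro a h1 h2
  rw [h' a, h a h1 h2]
  · intro h3; have := h1 h3; simp only [vr] at *; omega
  · intro h3; have := h2 h3; simp only [tm] at *; omega

theorem Agree.hasConsts {v t N : ℕ} {r r' : ℕ → ℕ} (h : Agree v t r r') (hc : HasConsts N r) :
    HasConsts N r' := by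
  obtain ⟨h1, h2, h3⟩ := hc
  refine ⟨?_, ?_, ?_⟩ <;> rw [h _ (by simp) (by simp)] <;> assumption

/-- The tables stored in the registers. -/
def tablesOf (r : ℕ → ℕ) : Tables := fun k i => r (tb k i)

theorem Agree.tablesOf {v t : ℕ} {r r' : ℕ → ℕ} (h : Agree v t r r') :
    tablesOf r' = tablesOf r := by
  funext k i
  have := k.2
  exact h _ (by simp only [tb]; omega) (by simp only [tb]; omega)

/-- The registers hold the values of the variables below `v`. -/
def HasVars (v : ℕ) (ρ r : ℕ → ℕ) : Prop := ∀ x < v, r (vr x) = ρ x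

theorem Agree.hasVars {v v' t : ℕ} {ρ r r' : ℕ → ℕ} (h : Agree v' t r r') (hv : HasVars v ρ r)
    (hvv : v ≤ v') : HasVars v ρ r' := by
  intro x hx
  rw [h _ (by simp only [vr]; omega) (by simp only [vr]; omega), hv x hx]

/-- Correctness of the code of one expression. -/
def Ex.Correct (P : RAMProgram) (w : List ℕ) (N : ℕ) (e : Ex) : Prop :=
  ∀ v t off (ρ r : ℕ → ℕ), CodeAt P off (e.code v t off) → HasConsts N r → HasVars v ρ r →
    ∃ r', Reach P w (e.cost N) ⟨off, r⟩ ⟨off + (e.code v t off).length, r'⟩ ∧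
      r' (tm t) = e.eval w N (tablesOf r) v ρ ∧ Agree v t r r'

theorem addrCode_straight (k : Fin 8) (t : ℕ) : ∀ a ∈ addrCode k t, a.Straight := by
  simp [addrCode, RAMInstr.Straight]

theorem CodeAt.reach_addrCode {P : RAMProgram} (w : List ℕ) {k : Fin 8} {t off : ℕ}
    (r : ℕ → ℕ) (h : CodeAt P off (addrCode k t)) :
    ∃ r', Reach P w 6 ⟨off, r⟩ ⟨off + 6, r'⟩ ∧ r' (tm t) = tb k (r (tm t)) ∧
      ∀ v, Agree v t r r' := by
  have hne : tm (t + 1) ≠ tm t := by simp [tm]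
  refine ⟨_, h.reach_straight w _ off r (addrCode_straight k t), ?_, ?_⟩
  · simp [addrCode, effect, RAMProgram.exec, tb, hne.symm]; omega
  · intro v a _ h2
    have h3 : a ≠ tm t := by rintro rfl; simp [tm] at h2
    have h4 : a ≠ tm (t + 1) := by rintro rfl; simp [tm] at h2
    simp [addrCode, effect, RAMProgram.exec, h3, h4]

theorem Agree.update_tm {v t t' : ℕ} {r r' : ℕ → ℕ} (h : Agree v t r r') (ht : t ≤ t') (x : ℕ) :
    Agree v t r (Function.update r' (tm t') x) := by
  intro a h1 h2
  have : a ≠ tm t' := by rintro rfl; simp only [tm] at h2; omega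
  rw [Function.update_of_ne this, h a h1 h2]

theorem Agree.update_vr {v v' t : ℕ} {r r' : ℕ → ℕ} (h : Agree v t r r') (hv : v ≤ v') (x : ℕ) :
    Agree v t r (Function.update r' (vr v') x) := by
  intro a h1 h2
  have : a ≠ vr v' := by rintro rfl; simp only [vr] at h1; omega
  rw [Function.update_of_ne this, h a h1 h2]

theorem Agree.weaken {v t v' t' : ℕ} {r r' : ℕ → ℕ} (h : Agree v' t' r r') (hv : v ≤ v')
    (ht : t ≤ t') : Agree v t r r' :=
  Agree.trans (fun _ _ _ => rfl) h hv ht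

theorem Agree.refl (v t : ℕ) (r : ℕ → ℕ) : Agree v t r r := fun _ _ _ => rfl

theorem tm_ne_vr (t v : ℕ) : tm t ≠ vr v := by simp only [tm, vr]; omega
theorem vr_ne_tm (t v : ℕ) : vr v ≠ tm t := by simp only [tm, vr]; omega
theorem vr_ne_const {v c : ℕ} (h : c % 16 ≠ 1) : c ≠ vr v := by simp only [vr]; omega
theorem tm_ne_const {v c : ℕ} (h : c % 16 ≠ 2) : c ≠ tm v := by simp only [tm]; omega

/-- A counted loop: the counter register `tm t` holds `j`, the code at `off` leaves the loop for
`off'` if the counter is `0`, and otherwise one round decreases the counter, increases the number of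
completed rounds, and preserves the invariant `I`. -/
theorem Reach.loop {P : RAMProgram} {w : List ℕ} {off off' t N c : ℕ} {I : ℕ → (ℕ → ℕ) → Prop}
    (hexit : ∀ r, r (tm t) = 0 → Reach P w 1 ⟨off, r⟩ ⟨off', r⟩)
    (hround : ∀ i r, I i r → r (tm t) ≠ 0 → i < N →
      ∃ r', Reach P w c ⟨off, r⟩ ⟨off, r'⟩ ∧ r' (tm t) = r (tm t) - 1 ∧ I (i + 1) r')
    (r : ℕ → ℕ) (h0 : I 0 r) (hr : r (tm t) = N) :
    ∃ r', Reach P w (N * c + 1) ⟨off, r⟩ ⟨off', r'⟩ ∧ I N r' := by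
  have key : ∀ i ≤ N, ∃ r', Reach P w (i * c) ⟨off, r⟩ ⟨off, r'⟩ ∧ r' (tm t) = N - i ∧ I i r' := by
    intro i
    induction i with
    | zero => exact fun _ => ⟨r, Reach.refl _ _ _ _, by simpa using hr, h0⟩
    | succ i ih =>
      intro hi
      obtain ⟨r1, h1, h2, h3⟩ := ih (by omega)
      obtain ⟨r2, h4, h5, h6⟩ := hround i r1 h3 (by omega) (by omega)
      exact ⟨r2, by rw [add_mul, one_mul]; exact h1.trans h4, by omega, h6⟩
  obtain ⟨r', h1, h2, h3⟩ := key N le_rfl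
  exact ⟨r', h1.trans (hexit r' (by omega)), h3⟩

theorem Reach.cast {P : RAMProgram} {w : List ℕ} {k p q : ℕ} {c : RAMConfig} {r : ℕ → ℕ}
    (h : Reach P w k c ⟨p, r⟩) (hq : p = q) : Reach P w k c ⟨q, r⟩ := hq ▸ h

theorem CodeAt.reach_jump {P : RAMProgram} {off m : ℕ} {t : ℕ} {l : List RAMInstr}
    (h : CodeAt P off (.jumpZero t m :: l)) (w : List ℕ) {r : ℕ → ℕ} (hr : r t = 0) :
    Reach P w 1 ⟨off, r⟩ ⟨m, r⟩ := by
  simpa [RAMProgram.exec, hr] using h.reach w r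

theorem CodeAt.reach_noJump {P : RAMProgram} {off m : ℕ} {t : ℕ} {l : List RAMInstr}
    (h : CodeAt P off (.jumpZero t m :: l)) (w : List ℕ) {r : ℕ → ℕ} (hr : r t ≠ 0) :
    Reach P w 1 ⟨off, r⟩ ⟨off + 1, r⟩ := by
  simpa [RAMProgram.exec, hr] using h.reach w r

/-- Correctness of the code of a binary operation. -/
theorem Ex.correct_binary {P : RAMProgram} {w : List ℕ} {N : ℕ} {a b : Ex}
    (ha : a.Correct P w N) (hb : b.Correct P w N) {v t off : ℕ} {ρ r : ℕ → ℕ} {i : RAMInstr}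
    (h : CodeAt P off (a.code v t off ++ b.code v (t + 1) (off + (a.code v t off).length) ++ [i]))
    (hc : HasConsts N r) (hv : HasVars v ρ r) (f : ℕ → ℕ → ℕ)
    (hi : ∀ r pc, RAMProgram.exec w ⟨pc, r⟩ i =
      ⟨pc + 1, Function.update r (tm t) (f (r (tm t)) (r (tm (t + 1))))⟩) :
    ∃ r', Reach P w (a.cost N + b.cost N + 1) ⟨off, r⟩ ⟨off + (a.code v t off ++
        b.code v (t + 1) (off + (a.code v t off).length) ++ [i]).length, r'⟩ ∧
      r' (tm t) = f (a.eval w N (tablesOf r) v ρ) (b.eval w N (tablesOf r) v ρ) ∧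
      Agree v t r r' := by
  obtain ⟨r1, h1, h2, h3⟩ := ha v t off ρ r h.left.left hc hv
  obtain ⟨r2, h4, h5, h6⟩ := hb v (t + 1) _ ρ r1 h.left.right (h3.hasConsts hc)
    (h3.hasVars hv le_rfl)
  have h7 := h.right.reach w r2
  rw [hi] at h7
  simp only [List.length_append, List.length_cons, List.length_nil, ← add_assoc] at h1 h4 h7 ⊢
  refine ⟨_, (h1.trans h4).trans h7, ?_, (h3.trans h6 le_rfl (by omega)).update_tm le_rfl _⟩
  rw [Function.update_self, h5, h3.tablesOf, h6 (tm t) (by simp [tm]) (by simp [tm]), h2]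

theorem Ex.correct_ite {P : RAMProgram} {w : List ℕ} {N : ℕ} {c a b : Ex}
    (hc : c.Correct P w N) (ha : a.Correct P w N) (hb : b.Correct P w N) :
    (Ex.ite c a b).Correct P w N := by
  intro v t off ρ r h hcs hv
  simp only [Ex.code] at h ⊢
  obtain ⟨r1, h1, h2, h3⟩ := hc v t off ρ r h.left hcs hv
  replace h := h.right
  have hcs1 := h3.hasConsts hcs
  have hv1 := h3.hasVars hv le_rfl
  by_cases h0 : r1 (tm t) = 0
  · have h4 := h.left.reach_jump w h0
    replace h := h.right.right.right
    obtain ⟨r2, h5, h6, h7⟩ := hb v t (off + (c.code v t off).length + 1 +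
      (a.code v t (off + (c.code v t off).length + 1)).length + 1) ρ r1 h hcs1 hv1
    refine ⟨r2, (((h1.trans h4).trans h5).mono ?_).cast ?_, ?_, h3.trans h7 le_rfl le_rfl⟩
    · simp only [Ex.cost]; omega
    · simp only [List.length_append, List.length_cons, List.length_nil]; omega
    · rw [h6, Ex.eval, ← h2, if_pos h0, h3.tablesOf]
  · have h4 := h.left.reach_noJump w h0
    replace h := h.right
    obtain ⟨r2, h5, h6, h7⟩ := ha v t (off + (c.code v t off).length + 1) ρ r1 h.left hcs1 hv1
    -- Register 3 always holds 0, so a `jumpZero` on it is unconditional.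
    have h8 := h.right.left.reach_jump w (h7.hasConsts hcs1).1
    refine ⟨r2, ((((h1.trans h4).trans h5).trans h8).mono ?_).cast ?_, ?_,
      h3.trans h7 le_rfl le_rfl⟩
    · simp only [Ex.cost]; omega
    · simp only [List.length_append, List.length_cons, List.length_nil]; omega
    · rw [h6, Ex.eval, ← h2, if_neg h0, h3.tablesOf]

/-- Multiplication is repeated addition: `tm t` accumulates, `tm (t + 1)` counts down, and `tm (t +
2)` keeps the operand, which is evaluated once before the loop. -/
theorem Ex.correct_mulN {P : RAMProgram} {w : List ℕ} {N : ℕ} {a : Ex}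
    (ha : a.Correct P w N) : (Ex.mulN a).Correct P w N := by
  intro v t off ρ r h hcs hv
  simp only [Ex.code] at h ⊢
  obtain ⟨r1, h1, h2, h3⟩ := ha v (t + 2) off ρ r h.left hcs hv
  replace h := h.right
  set o := off + (a.code v (t + 2) off).length with ho
  have hcs1 := h3.hasConsts hcs
  have h4 := h.left.reach_straight w _ o r1 (by simp [RAMInstr.Straight])
  replace h := h.right
  set r2 := List.foldl (effect w) r1 [.const (tm t) 0, .add (tm (t + 1)) 4 3] with hr2
  have hr2' : r2 = Function.update (Function.update r1 (tm t) 0) (tm (t + 1)) N := by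
    simp [hr2, effect, RAMProgram.exec, tm_ne_const, hcs1.1, hcs1.2.1]
  have e1 : tm (t + 1) ≠ tm t := by simp [tm]
  have e2 : tm (t + 2) ≠ tm t := by simp [tm]
  have e3 : tm (t + 2) ≠ tm (t + 1) := by simp [tm]
  obtain ⟨r3, h5, h6, h7⟩ := Reach.loop (P := P) (w := w) (off := o + 2) (off' := o + 2 + 4)
    (t := t + 1) (N := N) (c := 4)
    (I := fun i r' => r' (tm t) = r1 (tm (t + 2)) * i ∧ r' (tm (t + 2)) = r1 (tm (t + 2)) ∧
      Agree v t r r')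
    (fun r' hr' => h.reach_jump w hr') (by
      rintro i r' ⟨i1, i2, i3⟩ hne hi
      have k1 := h.reach_noJump w hne
      have k2 := CodeAt.reach_straight w [.add (tm t) (tm t) (tm (t + 2)),
        .sub (tm (t + 1)) (tm (t + 1)) 5] _ r' (CodeAt.left (l' := [_]) h.tail)
        (by simp [RAMInstr.Straight])
      have hr3 : List.foldl (effect w) r' [.add (tm t) (tm t) (tm (t + 2)),
          .sub (tm (t + 1)) (tm (t + 1)) 5] = Function.update (Function.update r' (tm t)
          (r' (tm t) + r' (tm (t + 2)))) (tm (t + 1)) (r' (tm (t + 1)) - 1) := by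
        simp [effect, RAMProgram.exec, e1, tm_ne_const, (i3.hasConsts hcs).2.2]
      rw [hr3] at k2
      have i4 := (i3.update_tm le_rfl (r' (tm t) + r' (tm (t + 2)))).update_tm
        (Nat.le_succ t) (r' (tm (t + 1)) - 1)
      have k3 := (CodeAt.right (l := [_, _]) h.tail).reach_jump w (i4.hasConsts hcs).1
      refine ⟨_, ((k1.trans k2).trans k3).cast rfl, by simp, ?_, ?_, i4⟩
      · simp [e1.symm, i1, i2, mul_add]
      · simp [e2, e3, i2])
    r2 ⟨by simp [hr2', e1.symm], by simp [hr2', e2, e3], by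
      rw [hr2']
      exact ((h3.weaken le_rfl (by omega)).update_tm le_rfl _).update_tm (Nat.le_succ t) _⟩
    (by simp [hr2'])
  refine ⟨r3, (((h1.trans h4).trans h5).mono ?_).cast ?_, ?_, h7.2⟩
  · simp only [Ex.cost, List.length_cons, List.length_nil]; omega
  · simp only [List.length_append, List.length_cons, List.length_nil]; omega
  · rw [h6, h2, Ex.eval]

theorem HasVars.update {v : ℕ} {ρ r : ℕ → ℕ} (h : HasVars v ρ r) {i : ℕ} (hi : r (vr v) = i) :
    HasVars (v + 1) (Function.update ρ v i) r := by
  intro x hx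
  by_cases hxv : x = v
  · subst hxv; simp [hi]
  · rw [Function.update_of_ne hxv, h x (by omega)]

/-- The body uses variables from `v + 1` and temporaries from `t + 2` on, so it cannot disturb the
loop variable, the accumulator or the counter. Expressions never change tables, so every summand is
evaluated with the original ones. -/
theorem Ex.correct_sum {P : RAMProgram} {w : List ℕ} {N : ℕ} {e : Ex}
    (he : e.Correct P w N) : (Ex.sum e).Correct P w N := by
  intro v t off ρ r h hcs hv
  simp only [Ex.code] at h ⊢
  have h4 := h.left.reach_straight w _ off r (by simp [RAMInstr.Straight])
  replace h := h.right
  set L := (e.code (v + 1) (t + 2) (off + 4)).length with hL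
  set r2 := List.foldl (effect w) r [.const (tm t) 0, .const (vr v) 0, .add (tm (t + 1)) 4 3]
    with hr2
  have hr2' : r2 = Function.update (Function.update (Function.update r (tm t) 0) (vr v) 0)
      (tm (t + 1)) N := by
    simp [hr2, effect, RAMProgram.exec, tm_ne_const, vr_ne_const, hcs.1, hcs.2.1]
  have e1 : tm (t + 1) ≠ tm t := by simp [tm]
  have e2 : tm (t + 2) ≠ tm t := by simp [tm]
  have e3 : tm (t + 2) ≠ tm (t + 1) := by simp [tm]
  have e4 := tm_ne_vr
  have e5 := vr_ne_tm
  have ha2 : Agree v t r r2 := by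
    rw [hr2']
    exact (((Agree.refl v t r).update_tm le_rfl _).update_vr le_rfl _).update_tm (Nat.le_succ t) _
  obtain ⟨r3, h5, h6, -, h7⟩ := Reach.loop (P := P) (w := w) (off := off + 3)
    (off' := off + 4 + L + 4) (t := t + 1) (N := N) (c := e.cost N + 5)
    (I := fun k r' => r' (tm t) = ∑ i ∈ Finset.range k,
        e.eval w N (tablesOf r) (v + 1) (Function.update ρ v i) ∧ r' (vr v) = k ∧ Agree v t r r')
    (fun r' hr' => h.left.reach_jump w hr') (by
      rintro i r' ⟨i1, i2, i3⟩ hne hi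
      have k1 := h.left.reach_noJump w hne
      have hcs' := i3.hasConsts hcs
      obtain ⟨r4, k2, k3, k4⟩ := he (v + 1) (t + 2) (off + 4) _ r' h.right.left hcs'
        ((i3.hasVars hv le_rfl).update i2)
      have h' := h.right.right
      have i5 := i3.trans k4 (Nat.le_succ v) (by omega)
      have k5 := CodeAt.reach_straight w [.add (tm t) (tm t) (tm (t + 2)),
        .add (vr v) (vr v) 5, .sub (tm (t + 1)) (tm (t + 1)) 5] _ r4 (CodeAt.left (l' := [_]) h')
        (by simp [RAMInstr.Straight])
      have hr3 : List.foldl (effect w) r4 [.add (tm t) (tm t) (tm (t + 2)),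
          .add (vr v) (vr v) 5, .sub (tm (t + 1)) (tm (t + 1)) 5] =
          Function.update (Function.update (Function.update r4 (tm t)
          (r4 (tm t) + r4 (tm (t + 2)))) (vr v) (r4 (vr v) + 1)) (tm (t + 1))
          (r4 (tm (t + 1)) - 1) := by
        simp [effect, RAMProgram.exec, e1, e4, e5, tm_ne_const, vr_ne_const,
          (i5.hasConsts hcs).2.2]
      rw [hr3] at k5
      have i4 := ((i5.update_tm le_rfl (r4 (tm t) + r4 (tm (t + 2)))).update_vr le_rfl
        (r4 (vr v) + 1)).update_tm (Nat.le_succ t) (r4 (tm (t + 1)) - 1)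
      have k6 := (CodeAt.right (l := [_, _, _]) h').reach_jump w (i4.hasConsts hcs).1
      have f1 : r4 (tm (t + 1)) = r' (tm (t + 1)) := k4 _ (by simp [tm]) (by simp [tm])
      have f2 : r4 (tm t) = r' (tm t) := k4 _ (by simp [tm]) (by simp [tm])
      have f3 : r4 (vr v) = r' (vr v) := k4 _ (by simp [vr]) (by simp [vr])
      refine ⟨_, (((k1.trans k2).trans k5).trans k6).mono ?_, by simp [f1], ?_, ?_, i4⟩
      · simp only [List.length_cons, List.length_nil]; omega
      · simp [e1.symm, e4, f2, i1, k3, Finset.sum_range_succ, i3.tablesOf]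
      · simp [e5, f3, i2])
    r2 ⟨by simp [hr2', e1.symm, e4], by simp [hr2', e5], ha2⟩ (by simp [hr2'])
  refine ⟨r3, ((h4.trans h5).mono ?_).cast ?_, ?_, h7⟩
  · simp only [Ex.cost, List.length_cons, List.length_nil]; omega
  · simp only [List.length_append, List.length_cons, List.length_nil]; omega
  · rw [h6, Ex.eval]

theorem Ex.correct (P : RAMProgram) (w : List ℕ) (N : ℕ) (e : Ex) : e.Correct P w N := by
  induction e with
  | num c =>
    intro v t off ρ r h _ _
    exact ⟨_, h.reach w r, by simp [Ex.eval], (Agree.refl v t r).update_tm le_rfl _⟩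
  | var x =>
    intro v t off ρ r h hc hv
    by_cases hx : x < v
    · simp only [Ex.code, if_pos hx] at h ⊢
      exact ⟨_, h.reach w r, by simp [Ex.eval, hx, hc.1, hv x hx],
        (Agree.refl v t r).update_tm le_rfl _⟩
    · simp only [Ex.code, if_neg hx] at h ⊢
      exact ⟨_, h.reach w r, by simp [Ex.eval, hx], (Agree.refl v t r).update_tm le_rfl _⟩
  | len =>
    intro v t off ρ r h hc _
    exact ⟨_, h.reach w r, by simp [Ex.eval, hc.1, hc.2.1], (Agree.refl v t r).update_tm le_rfl _⟩
  | add a b ha hb =>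
    intro v t off ρ r h hc hv
    exact Ex.correct_binary ha hb h hc hv (· + ·) fun _ _ => rfl
  | sub a b ha hb =>
    intro v t off ρ r h hc hv
    exact Ex.correct_binary ha hb h hc hv (· - ·) fun _ _ => rfl
  | inp a ha =>
    intro v t off ρ r h hc hv
    simp only [Ex.code] at h ⊢
    obtain ⟨r1, h1, h2, h3⟩ := ha v t off ρ r h.left hc hv
    refine ⟨_, (h1.trans (h.right.reach w r1)).cast ?_, ?_, h3.update_tm le_rfl _⟩
    · simp [add_assoc]
    · simp [Ex.eval, h2]
  | tab k a ha =>
    intro v t off ρ r h hc hv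
    simp only [Ex.code] at h ⊢
    obtain ⟨r1, h1, h2, h3⟩ := ha v t off ρ r h.left hc hv
    obtain ⟨r2, h4, h5, h6⟩ := h.right.left.reach_addrCode w r1
    have h7 := h3.trans (h6 v) le_rfl le_rfl
    refine ⟨_, ((h1.trans h4).trans (h.right.right.reach w r2)).cast ?_, ?_,
      h7.update_tm le_rfl _⟩
    · simp [add_assoc, addrCode]
    · simp only [Function.update_self]
      rw [h5, h2, Ex.eval, ← h7.tablesOf]; rfl
  | ite c a b hc ha hb => exact Ex.correct_ite hc ha hb
  | mulN a ha => exact Ex.correct_mulN ha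
  | sum e he => exact Ex.correct_sum he

/-! ### Correctness of statement code -/

/-- `r'` agrees with `r` except at variables from `v` on, at temporaries from `t` on, and at
tables. -/
def AgreeScalars (v t : ℕ) (r r' : ℕ → ℕ) : Prop :=
  ∀ a, a % 16 < 8 → (a % 16 = 1 → a < vr v) → (a % 16 = 2 → a < tm t) → r' a = r a

theorem Agree.scalars {v t : ℕ} {r r' : ℕ → ℕ} (h : Agree v t r r') : AgreeScalars v t r r' :=
  fun a _ => h a

theorem AgreeScalars.trans {v t v' t' : ℕ} {r r' r'' : ℕ → ℕ} (h : AgreeScalars v t r r')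
    (h' : AgreeScalars v' t' r' r'') (hv : v ≤ v') (ht : t ≤ t') : AgreeScalars v t r r'' := by
  intro a h0 h1 h2
  rw [h' a h0, h a h0 h1 h2]
  · intro h3; have := h1 h3; simp only [vr] at *; omega
  · intro h3; have := h2 h3; simp only [tm] at *; omega

theorem AgreeScalars.hasConsts {v t N : ℕ} {r r' : ℕ → ℕ} (h : AgreeScalars v t r r')
    (hc : HasConsts N r) : HasConsts N r' := by
  obtain ⟨h1, h2, h3⟩ := hc
  refine ⟨?_, ?_, ?_⟩ <;> rw [h _ (by simp) (by simp) (by simp)] <;> assumption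

theorem AgreeScalars.hasVars {v v' t : ℕ} {ρ r r' : ℕ → ℕ} (h : AgreeScalars v' t r r')
    (hv : HasVars v ρ r) (hvv : v ≤ v') : HasVars v ρ r' := by
  intro x hx
  rw [h _ (by simp only [vr]; omega) (by simp only [vr]; omega) (by simp only [vr]; omega), hv x hx]

theorem tablesOf_update (r : ℕ → ℕ) (k : Fin 8) (i x : ℕ) :
    tablesOf (Function.update r (tb k i) x) =
      Function.update (tablesOf r) k (Function.update (tablesOf r k) i x) := by
  funext k' i'
  by_cases hk : k' = k
  · subst hk
    by_cases hi : i' = i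
    · subst hi; simp [tablesOf]
    · have : tb k' i' ≠ tb k' i := by simp only [tb]; omega
      simp [tablesOf, hi, this]
  · have : tb k' i' ≠ tb k i := by
      have h1 := k.2
      have h2 := k'.2
      have h3 : (k : ℕ) ≠ k' := fun h => hk (Fin.ext h.symm)
      simp only [tb]; omega
    simp [tablesOf, hk, this]

/-- Correctness of the code of a statement. -/
theorem Stmt.correct {P : RAMProgram} {w : List ℕ} {N : ℕ} (s : Stmt) :
    ∀ v t off (ρ r : ℕ → ℕ), CodeAt P off (s.code v t off) → HasConsts N r → HasVars v ρ r →
    ∃ r', Reach P w (s.cost N) ⟨off, r⟩ ⟨off + (s.code v t off).length, r'⟩ ∧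
      tablesOf r' = s.exec w N v ρ (tablesOf r) ∧ AgreeScalars v t r r' := by
  induction s with
  | store k a e =>
    intro v t off ρ r h hc hv
    simp only [Stmt.code] at h ⊢
    obtain ⟨r1, h1, h2, h3⟩ := Ex.correct P w N a v t off ρ r h.left.left hc hv
    obtain ⟨r2, h4, h5, h6⟩ := h.left.right.reach_addrCode w r1
    have h7 := h3.trans (h6 v) le_rfl le_rfl
    obtain ⟨r3, h8, h9, h10⟩ := Ex.correct P w N e v (t + 1) _ ρ r2 h.right.left
      (h7.hasConsts hc) (h7.hasVars hv le_rfl)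
    have h11 := h7.trans h10 le_rfl (Nat.le_succ t)
    have h12 : r3 (tm t) = tb k (a.eval w N (tablesOf r) v ρ) := by
      rw [h10 _ (by simp [tm]) (by simp [tm]), h5, h2]
    have h13 := h.right.right.reach w r3
    simp only [RAMProgram.exec, h12, h9, h7.tablesOf] at h13
    simp only [List.length_append, ← add_assoc] at h1 h4 h8 h13 ⊢
    refine ⟨_, (((h1.trans h4).trans h8).trans h13).mono ?_, ?_, ?_⟩
    · simp only [Stmt.cost]; omega
    · rw [tablesOf_update, h11.tablesOf, Stmt.exec]
    · intro x g0 g1 g2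
      rw [Function.update_of_ne, h11 x g1 g2]
      have := k.2
      simp only [tb]; omega
  | seq s s' hs hs' =>
    intro v t off ρ r h hc hv
    simp only [Stmt.code] at h ⊢
    obtain ⟨r1, h1, h2, h3⟩ := hs v t off ρ r h.left hc hv
    obtain ⟨r2, h4, h5, h6⟩ := hs' v t _ ρ r1 h.right (h3.hasConsts hc) (h3.hasVars hv le_rfl)
    exact ⟨r2, (h1.trans h4).cast (by simp [add_assoc]), by rw [h5, h2, Stmt.exec],
      h3.trans h6 le_rfl le_rfl⟩
  | loop s hs =>
    intro v t off ρ r h hcs hv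
    simp only [Stmt.code] at h ⊢
    have h4 := h.left.reach_straight w _ off r (by simp [RAMInstr.Straight])
    replace h := h.right
    set L := (s.code (v + 1) (t + 1) (off + 3)).length with hL
    set r2 := List.foldl (effect w) r [.const (vr v) 0, .add (tm t) 4 3] with hr2
    have hr2' : r2 = Function.update (Function.update r (vr v) 0) (tm t) N := by
      simp [hr2, effect, RAMProgram.exec, vr_ne_const, hcs.1, hcs.2.1]
    have e4 := tm_ne_vr
    have e5 := vr_ne_tm
    have ha2 : Agree v t r r2 := by
      rw [hr2']
      exact ((Agree.refl v t r).update_vr le_rfl _).update_tm le_rfl _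
    obtain ⟨r3, h5, h6, -, h7⟩ := Reach.loop (P := P) (w := w) (off := off + 2)
      (off' := off + 3 + L + 3) (t := t) (N := N) (c := s.cost N + 4)
      (I := fun k r' => tablesOf r' = iter (fun i => s.exec w N (v + 1) (Function.update ρ v i)) k
          (tablesOf r) ∧ r' (vr v) = k ∧ AgreeScalars v t r r')
      (fun r' hr' => h.left.reach_jump w hr') (by
        rintro i r' ⟨i1, i2, i3⟩ hne hi
        have k1 := h.left.reach_noJump w hne
        have hcs' := i3.hasConsts hcs
        obtain ⟨r4, k2, k3, k4⟩ := hs (v + 1) (t + 1) (off + 3) _ r' h.right.left hcs'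
          ((i3.hasVars hv le_rfl).update i2)
        have h' := h.right.right
        have i5 := i3.trans k4 (Nat.le_succ v) (Nat.le_succ t)
        have k5 := CodeAt.reach_straight w [.add (vr v) (vr v) 5, .sub (tm t) (tm t) 5] _ r4
          (CodeAt.left (l' := [_]) h') (by simp [RAMInstr.Straight])
        have hr3 : List.foldl (effect w) r4 [.add (vr v) (vr v) 5, .sub (tm t) (tm t) 5] =
            Function.update (Function.update r4 (vr v) (r4 (vr v) + 1)) (tm t)
            (r4 (tm t) - 1) := by
          simp [effect, RAMProgram.exec, e4, vr_ne_const, (i5.hasConsts hcs).2.2]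
        rw [hr3] at k5
        -- The comparison is with `r4` rather than `r`, because the bookkeeping must be seen to
        -- preserve the tables that the body has just changed.
        have i4 := ((Agree.refl v t r4).update_vr le_rfl (r4 (vr v) + 1)).update_tm le_rfl
          (r4 (tm t) - 1)
        have i6 := i5.trans i4.scalars le_rfl le_rfl
        have k6 := (CodeAt.right (l := [_, _]) h').reach_jump w (i6.hasConsts hcs).1
        have f2 : r4 (tm t) = r' (tm t) := k4 _ (by simp [tm]) (by simp [tm]) (by simp [tm])
        have f3 : r4 (vr v) = r' (vr v) := k4 _ (by simp [vr]) (by simp [vr]) (by simp [vr])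
        refine ⟨_, (((k1.trans k2).trans k5).trans k6).mono ?_, by simp [f2], ?_, ?_, i6⟩
        · simp only [List.length_cons, List.length_nil]; omega
        · rw [i4.tablesOf, k3, i1, iter]
        · simp [e5, f3, i2])
      r2 ⟨ha2.tablesOf, by simp [hr2', e5], ha2.scalars⟩ (by simp [hr2'])
    refine ⟨r3, ((h4.trans h5).mono ?_).cast ?_, ?_, h7⟩
    · simp only [Stmt.cost, List.length_cons, List.length_nil]; omega
    · simp only [List.length_append, List.length_cons, List.length_nil]; omega
    · rw [h6, Stmt.exec]

/-! ### Complete programs and their running time -/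

theorem Reach.outputsWithin {P : RAMProgram} {w : List ℕ} {k pc : ℕ} {r : ℕ → ℕ}
    (h : Reach P w k RAMProgram.init ⟨pc, r⟩) (hpc : P.length ≤ pc) :
    P.OutputsWithin w (r 0) k := by
  obtain ⟨s, hs, h⟩ := h
  have hfix : P.step w ⟨pc, r⟩ = ⟨pc, r⟩ := by
    simp [RAMProgram.step, List.getElem?_eq_none hpc]
  have : (P.step w)^[k] RAMProgram.init = ⟨pc, r⟩ := by
    obtain ⟨j, rfl⟩ := Nat.exists_eq_add_of_le hs
    rw [add_comm, Function.iterate_add_apply, h, Function.iterate_fixed hfix]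
  rw [RAMProgram.OutputsWithin, this]
  exact ⟨hpc, rfl⟩

/-- A statement followed by an expression, of nesting depth at most `d`, can be executed by a random
access machine in time `O(N ^ d)`, where `N - 1` is the first letter of the input. -/
theorem exists_ramProgram (s : Stmt) (e : Ex) {d : ℕ} (hs : s.depth ≤ d) (he : e.depth ≤ d) :
    ∃ (P : RAMProgram) (C : ℕ), ∀ w : List ℕ, P.OutputsWithin w
      (e.eval w (w.getD 0 0 + 1) (s.exec w (w.getD 0 0 + 1) 0 (fun _ => 0) fun _ _ => 0) 0
        fun _ => 0) (C * (w.getD 0 0 + 1) ^ d) := by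
  -- The constant 4 pays for the three instructions that set up `N` and `1` and for the final copy
  -- to register 0.
  obtain ⟨C, hC⟩ := ((s.polyBound_cost.mono hs).add (e.polyBound_cost.mono he)).add (.const 4 d)
  let pro : List RAMInstr := [.const 5 1, .read 4 3, .add 4 4 5]
  let cs := s.code 0 0 3
  let ce := e.code 0 0 (3 + cs.length)
  refine ⟨pro ++ (cs ++ (ce ++ [.add 0 (tm 0) 3])), C, fun w => ?_⟩
  set N := w.getD 0 0 + 1 with hN
  set P : RAMProgram := pro ++ (cs ++ (ce ++ [.add 0 (tm 0) 3])) with hP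
  have hcode : CodeAt P 0 (pro ++ (cs ++ (ce ++ [.add 0 (tm 0) 3]))) := ⟨[], [], by simp [hP], rfl⟩
  have h1 := hcode.left.reach_straight w _ 0 (fun _ => 0) (by simp [pro, RAMInstr.Straight])
  set r1 := List.foldl (effect w) (fun _ => 0) pro with hr1
  have hr1' : r1 = Function.update (Function.update (fun _ => 0) 5 1) 4 N := by
    simp [hr1, pro, effect, RAMProgram.exec, hN]
  have hc1 : HasConsts N r1 := by simp [hr1', HasConsts]
  have ht1 : tablesOf r1 = fun _ _ => 0 := by
    funext k i
    have h4 : tb k i ≠ 4 := by simp only [tb]; omega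
    have h5 : tb k i ≠ 5 := by simp only [tb]; omega
    simp [tablesOf, hr1', h4, h5]
  obtain ⟨r2, h2, h3, h4⟩ := s.correct 0 0 _ (fun _ => 0) r1 hcode.right.left hc1
    (fun x hx => absurd hx (Nat.not_lt_zero x))
  obtain ⟨r3, h5, h6, h7⟩ := e.correct P w N 0 0 _ (fun _ => 0) r2 hcode.right.right.left
    (h4.hasConsts hc1) (fun x hx => absurd hx (Nat.not_lt_zero x))
  have h8 := hcode.right.right.right.reach w r3
  have h9 := (((h1.trans h2).trans h5).trans h8)
  have hout := (h9.mono (k' := C * N ^ d) (by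
    have : s.cost N + e.cost N + 4 ≤ C * N ^ d := hC N (by omega)
    simp only [pro, List.length_cons, List.length_nil]
    omega)).outputsWithin (by
      simp only [hP, List.length_append, List.length_cons, List.length_nil]; omega)
  simpa [h6, h3, ht1, (h7.hasConsts (h4.hasConsts hc1)).1] using hout

/-! ### Orienting the complement of an interval graph -/

/-- Two different vertices below `n` which are not adjacent. -/
def NonAdj (A : ℕ → ℕ → Prop) (n a b : ℕ) : Prop := a < n ∧ b < n ∧ a ≠ b ∧ ¬ A a b

/-- An orientation `M` of some nonadjacent pairs is closed under forcing: if `a` precedes `b`, then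
`a` precedes the neighbours of `b` that it is not adjacent to, and likewise for `b`. -/
def ForceClosed (A : ℕ → ℕ → Prop) (n : ℕ) (M : ℕ → ℕ → Prop) : Prop :=
  (∀ a b c, M a b → A b c → NonAdj A n a c → M a c) ∧
    ∀ a b c, M a b → A a c → NonAdj A n c b → M c b

/-- The orientation of one nonadjacent pair forces that of another one directly. -/
def Force (A : ℕ → ℕ → Prop) (n : ℕ) (e f : ℕ × ℕ) : Prop :=
  NonAdj A n e.1 e.2 ∧ NonAdj A n f.1 f.2 ∧ (f.1 = e.1 ∧ A e.2 f.2 ∨ f.2 = e.2 ∧ A e.1 f.1)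

/-- The orientation of one nonadjacent pair forces that of another one. -/
def Forces (A : ℕ → ℕ → Prop) (n : ℕ) : ℕ × ℕ → ℕ × ℕ → Prop := Relation.ReflTransGen (Force A n)

/-- The graph `A` on the numbers below `n` is an interval graph, and `T` is the order of disjoint
intervals. -/
structure IsIntervalOrder (A : ℕ → ℕ → Prop) (n : ℕ) (T : ℕ → ℕ → Prop) : Prop where
  symm : ∀ a b, A a b → A b a
  lt : ∀ a b, A a b → a < n ∧ b < n
  closed : ForceClosed A n T
  iff : ∀ a b, NonAdj A n a b ↔ T a b ∨ T b a
  asymm : ∀ a b, T a b → ¬ T b a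
  noC4 : ∀ a b c d, A a b → A b c → A c d → A d a → NonAdj A n a c → NonAdj A n b d → False

/-- The properties of a partial orientation of the complement that are preserved when an unoriented
pair, with first entry as small as possible, is oriented together with all pairs that it forces. -/
structure IsPartialOrientation (A : ℕ → ℕ → Prop) (n : ℕ) (M : ℕ → ℕ → Prop) : Prop where
  sub : ∀ a b, M a b → NonAdj A n a b
  closed : ForceClosed A n M
  asymm : ∀ a b, M a b → ¬ M b a
  leader : ∀ a b, M a b → ∃ p, Forces A n (a, b) p ∧
    ∀ e, Forces A n (a, b) e → p.1 ≤ e.1 ∧ p.1 ≤ e.2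

section

variable {A : ℕ → ℕ → Prop} {n : ℕ} {M M' T : ℕ → ℕ → Prop}

theorem NonAdj.symm (hA : ∀ a b, A a b → A b a) {a b : ℕ} (h : NonAdj A n a b) : NonAdj A n b a :=
  ⟨h.2.1, h.1, h.2.2.1.symm, fun h' => h.2.2.2 (hA _ _ h')⟩

theorem ForceClosed.of_force (hM : ForceClosed A n M) {e e' : ℕ × ℕ} (h : Force A n e e')
    (he : M e.1 e.2) : M e'.1 e'.2 := by
  obtain ⟨a, b⟩ := e
  obtain ⟨a', b'⟩ := e'
  obtain ⟨-, h, ⟨rfl, h'⟩ | ⟨rfl, h'⟩⟩ := h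
  · exact hM.1 _ _ _ he h' h
  · exact hM.2 _ _ _ he h' h

theorem ForceClosed.of_forces (hM : ForceClosed A n M) {e e' : ℕ × ℕ} (h : Forces A n e e')
    (he : M e.1 e.2) : M e'.1 e'.2 := by
  induction h with
  | refl => exact he
  | tail _ h ih => exact hM.of_force h ih

/-- Each direct forcing can be undone by the same adjacency, so forcing is an equivalence relation
on oriented nonadjacent pairs; with `Forces.swap` it also respects reversal. -/
theorem Forces.symm (hA : ∀ a b, A a b → A b a) {e e' : ℕ × ℕ} (h : Forces A n e e') :
    Forces A n e' e := by
  induction h with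
  | refl => exact .refl
  | tail _ h ih =>
    exact .head ⟨h.2.1, h.1, h.2.2.imp (fun h => ⟨h.1.symm, hA _ _ h.2⟩)
      fun h => ⟨h.1.symm, hA _ _ h.2⟩⟩ ih

theorem Forces.swap (hA : ∀ a b, A a b → A b a) {e e' : ℕ × ℕ} (h : Forces A n e e') :
    Forces A n e.swap e'.swap := by
  induction h with
  | refl => exact .refl
  | tail _ h ih => exact ih.tail ⟨h.1.symm hA, h.2.1.symm hA, h.2.2.symm⟩

theorem forceClosed_forces {u v : ℕ} (huv : NonAdj A n u v) :
    ForceClosed A n (fun a b => Forces A n (u, v) (a, b)) := by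
  have hH : ∀ e, Forces A n (u, v) e → NonAdj A n e.1 e.2 := by
    intro e h
    cases h with
    | refl => exact huv
    | tail _ h => exact h.2.1
  exact ⟨fun a b c h hb hc => h.tail ⟨hH _ h, hc, .inl ⟨rfl, hb⟩⟩,
    fun a b c h hb hc => h.tail ⟨hH _ h, hc, .inr ⟨rfl, hb⟩⟩⟩

/-- The new class is disjoint from `M` and from its reverse, since `M` is closed and forcing is
symmetric. Hence conflicts could arise only inside the class, where the true order `T` excludes
them. -/
theorem IsPartialOrientation.extend (hT : IsIntervalOrder A n T) (hM : IsPartialOrientation A n M)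
    {u v : ℕ} (huv : NonAdj A n u v) (h1 : ¬ M u v) (h2 : ¬ M v u)
    (hcov : ∀ x < u, ∀ y, NonAdj A n x y → M x y ∨ M y x) (hclosed : ForceClosed A n M')
    (hM' : ∀ a b, M' a b → M a b ∨ Forces A n (u, v) (a, b)) :
    IsPartialOrientation A n M' := by
  have hA := hT.symm
  have hH : ∀ e, Forces A n (u, v) e → NonAdj A n e.1 e.2 := by
    intro e h
    cases h with
    | refl => exact huv
    | tail _ h => exact h.2.1
  have hnot : ∀ a b, Forces A n (u, v) (a, b) → ¬ M a b ∧ ¬ M b a := fun a b h =>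
    ⟨fun h' => h1 (hM.closed.of_forces (h.symm hA) h'),
      fun h' => h2 (hM.closed.of_forces ((h.swap hA).symm hA) h')⟩
  refine ⟨fun a b h => (hM' a b h).elim (hM.sub a b) (hH (a, b)), hclosed, fun a b h h' => ?_,
    fun a b h => ?_⟩
  · rcases hM' _ _ h with h | h <;> rcases hM' _ _ h' with h' | h'
    · exact hM.asymm _ _ h h'
    · exact (hnot _ _ h').2 h
    · exact (hnot _ _ h).2 h'
    -- `T` contains one of the two orientations of this pair; being closed, it would contain the
    -- other as well.
    · have hab : Forces A n (a, b) (b, a) := (h.symm hA).trans h'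
      rcases (hT.iff a b).1 (hH _ h) with ht | ht
      · exact hT.asymm _ _ ht (hT.closed.of_forces hab ht)
      · exact hT.asymm _ _ ht (hT.closed.of_forces (hab.symm hA) ht)
  · rcases hM' _ _ h with h | h
    · exact hM.leader a b h
    -- The leader of the class is `(u, v)`: pairs with an entry below `u` are already oriented by
    -- `hcov`, hence are not in the new class.
    · refine ⟨(u, v), h.symm hA, fun e he => ?_⟩
      have he := h.trans he
      obtain ⟨x, y⟩ := e
      have hxy := hH _ he
      have hn := hnot _ _ he
      constructor
      · by_contra! hlt
        rcases hcov _ hlt _ hxy with h | h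
        exacts [hn.1 h, hn.2 h]
      · by_contra! hlt
        rcases hcov _ hlt _ (hxy.symm hA) with h | h
        exacts [hn.2 h, hn.1 h]

/-- A directed triangle can be moved along the pairs that are forced by one of its sides. -/
theorem IsPartialOrientation.move_triangle (hA : ∀ a b, A a b → A b a)
    (hM : IsPartialOrientation A n M) {a b c : ℕ} (h1 : M a b) (h2 : M b c) (h3 : M c a)
    {e : ℕ × ℕ} (h : Forces A n (a, b) e) :
    M e.1 e.2 ∧ M e.2 c ∧ M c e.1 ∧ Forces A n (c, a) (c, e.1) := by
  induction h with
  | refl => exact ⟨h1, h2, h3, .refl⟩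
  | @tail e e' _ h ih =>
    obtain ⟨i1, i2, i3, i4⟩ := ih
    have h5 := hM.closed.of_force h i1
    obtain ⟨a, b⟩ := e
    obtain ⟨a', b'⟩ := e'
    obtain ⟨-, h, ⟨h6, h'⟩ | ⟨h6, h'⟩⟩ := h
    · dsimp only at *
      subst h6
      refine ⟨h5, ?_, i3, i4⟩
      -- If `b'` were adjacent to `c`, then `a → b'` would force `a → c`, against `c → a`. So `b →
      -- c` forces `b' → c`.
      have hb : NonAdj A n b' c := by
        refine ⟨h.2.1, (hM.sub _ _ i3).1, ?_, fun hbc => ?_⟩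
        · rintro rfl
          exact hM.asymm _ _ i3 h5
        · exact hM.asymm _ _ i3 (hM.closed.1 _ _ _ h5 hbc ((hM.sub _ _ i3).symm hA))
      exact hM.closed.2 _ _ _ i2 h' hb
    · dsimp only at *
      subst h6
      have hb : NonAdj A n c a' := by
        refine ⟨(hM.sub _ _ i3).1, h.1, ?_, fun hca => ?_⟩
        · rintro rfl
          exact hM.asymm _ _ i2 h5
        · exact hM.asymm _ _ i2 (hM.closed.2 _ _ _ h5 (hA _ _ hca) ((hM.sub _ _ i2).symm hA))
      exact ⟨h5, i2, hM.closed.1 _ _ _ i3 h' hb,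
        i4.tail ⟨hM.sub _ _ i3, hb, .inl ⟨rfl, h'⟩⟩⟩

/-- A triangle `a → b → c → a` can be moved so that its side `a → b` becomes the leader `(u, v)` of
its class; the side from `c` becomes `(c, u)` and stays in the class of `(c, a)`. If the leader
`(u', y)` of that class satisfies `u ≤ u'`, minimality of `u'` gives `u = u'`. Moving the new
triangle until its side `(c, u)` becomes `(u, y)` then yields `v → u`, contradicting `u → v`. -/
theorem IsPartialOrientation.not_triangle (hA : ∀ a b, A a b → A b a)
    (hM : IsPartialOrientation A n M) {a b c : ℕ} (h1 : M a b) (h2 : M b c) (h3 : M c a) :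
    False := by
  have key : ∀ a b c, M a b → M b c → M c a → ∀ p q, Forces A n (a, b) p → Forces A n (c, a) q →
      (∀ e, Forces A n (c, a) e → q.1 ≤ e.1 ∧ q.1 ≤ e.2) → p.1 ≤ q.1 → False := by
    rintro a b c h1 h2 h3 ⟨u, v⟩ ⟨u', y⟩ hp hq hmin hle
    obtain ⟨i1, i2, i3, i4⟩ := hM.move_triangle hA h1 h2 h3 hp
    obtain rfl : u = u' := le_antisymm hle (hmin _ i4).2
    obtain ⟨-, -, j, -⟩ := hM.move_triangle hA i3 i1 i2 ((i4.symm hA).trans hq)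
    exact hM.asymm _ _ i1 j
  obtain ⟨p, hp, hp'⟩ := hM.leader _ _ h1
  obtain ⟨q, hq, hq'⟩ := hM.leader _ _ h2
  obtain ⟨r, hr, hr'⟩ := hM.leader _ _ h3
  -- Of three numbers arranged in a cycle, one is at most its cyclic predecessor; the rotation of
  -- `key` is chosen accordingly.
  by_cases c1 : p.1 ≤ r.1
  · exact key _ _ _ h1 h2 h3 p r hp hr hr' c1
  by_cases c2 : q.1 ≤ p.1
  · exact key _ _ _ h2 h3 h1 q p hq hp hp' c2
  · exact key _ _ _ h3 h1 h2 r q hr hq hq' (by omega)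

/-- The ends of a path `a → b → c` are nonadjacent, because otherwise `a → b` would force `c → b`.
The pair is therefore oriented, and `c → a` would close a directed triangle. -/
theorem IsPartialOrientation.trans (hA : ∀ a b, A a b → A b a)
    (hM : IsPartialOrientation A n M) (hcov : ∀ x y, NonAdj A n x y → M x y ∨ M y x)
    {a b c : ℕ} (h1 : M a b) (h2 : M b c) : M a c := by
  have hb := hM.sub _ _ h1
  have hc := hM.sub _ _ h2
  have hac : NonAdj A n a c := by
    refine ⟨hb.1, hc.2.1, ?_, fun h => ?_⟩
    · rintro rfl
      exact hM.asymm _ _ h1 h2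
    · exact hM.asymm _ _ h2 (hM.closed.2 _ _ _ h1 h (hc.symm hA))
  exact (hcov _ _ hac).resolve_right fun h => hM.not_triangle hA h1 h2 h

/-! ### Endpoints from a complete orientation -/

open Classical in
/-- The number of predecessors: the left end of the interval of `x`. -/
noncomputable def leftEnd (n : ℕ) (M : ℕ → ℕ → Prop) (x : ℕ) : ℕ :=
  ((Finset.range n).filter fun u => M u x).card

/-- Some vertex that does not come after `x` has its left end at `p` or later. -/
def Reaches (n : ℕ) (M : ℕ → ℕ → Prop) (x p : ℕ) : Prop :=
  ∃ w < n, ¬ M x w ∧ p ≤ leftEnd n M w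

theorem Reaches.mono (x : ℕ) (i j : ℕ) (hij : i ≤ j) : Reaches n M x j → Reaches n M x i :=
  fun ⟨w, h1, h2, h3⟩ => ⟨w, h1, h2, hij.trans h3⟩

open Classical in
/-- The largest left end among the vertices that do not come after `x`. -/
noncomputable def rightEnd (n : ℕ) (M : ℕ → ℕ → Prop) (x : ℕ) : ℕ :=
  ((Finset.range (n + 1)).filter (Reaches n M x)).card - 1

-- A downward closed set of numbers is an initial segment, so its cardinality is its first missing
-- element. This turns the count in `rightEnd` into a maximum.
open Classical in
theorem lt_card_filter_range_iff {p : ℕ → Prop} {N : ℕ} (hp : ∀ i j, i ≤ j → p j → p i)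
    {q : ℕ} : q < ((Finset.range N).filter p).card ↔ q < N ∧ p q := by
  induction N with
  | zero => simp
  | succ N ih =>
    rw [Finset.range_add_one, Finset.filter_insert]
    split_ifs with h
    · rw [Finset.card_insert_of_notMem (by simp)]
      have : (Finset.range N).filter p = Finset.range N :=
        Finset.filter_true_of_mem fun i hi => hp i N (Finset.mem_range.1 hi).le h
      rw [this, Finset.card_range]
      exact ⟨fun hq => ⟨hq, hp _ _ (by omega) h⟩, fun hq => hq.1⟩
    · rw [ih]
      refine ⟨fun hq => ⟨by omega, hq.2⟩, fun hq => ⟨?_, hq.2⟩⟩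
      rcases Nat.lt_succ_iff_lt_or_eq.1 hq.1 with h' | rfl
      exacts [h', absurd hq.2 h]

/-- A complete orientation represents the graph by intervals of natural numbers. -/
structure IsIntervalModel (A : ℕ → ℕ → Prop) (n : ℕ) (l r : ℕ → ℕ) : Prop where
  le : ∀ a < n, l a ≤ r a
  lt : ∀ a < n, r a < n
  adj_iff : ∀ a < n, ∀ b < n, a ≠ b → (A a b ↔ l a ≤ r b ∧ l b ≤ r a)

theorem leftEnd_lt {x : ℕ} (hM : IsPartialOrientation A n M) (hx : x < n) : leftEnd n M x < n := by
  classical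
  have : (Finset.range n).filter (fun u => M u x) ⊂ Finset.range n := by
    refine Finset.filter_ssubset.2 ⟨x, by simpa using hx, fun h => hM.asymm _ _ h h⟩
  simpa [leftEnd] using Finset.card_lt_card this

/-- Sets of predecessors are nested. Otherwise transitivity and closure make `u y x u'` a 4-cycle
whose diagonals `u x` and `y u'` are nonadjacent, which an interval graph does not contain. -/
theorem IsPartialOrientation.pred_total (hT : IsIntervalOrder A n T)
    (hM : IsPartialOrientation A n M) (hcov : ∀ x y, NonAdj A n x y → M x y ∨ M y x)
    {x y u u' : ℕ} (h1 : M u x) (h2 : ¬ M u y) (h3 : M u' y) (h4 : ¬ M u' x) : False := by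
  have hA := hT.symm
  have k1 := hM.sub _ _ h1
  have k3 := hM.sub _ _ h3
  have tr : ∀ {a b c}, M a b → M b c → M a c := fun h h' => hM.trans hA hcov h h'
  have fact : ∀ {x y u u'}, M u x → ¬ M u y → M u' y → ¬ M u' x → A u y := by
    intro x y u u' h1 h2 h3 h4
    by_contra h
    have hne : u ≠ y := by rintro rfl; exact h4 (tr h3 h1)
    exact (hcov u y ⟨(hM.sub _ _ h1).1, (hM.sub _ _ h3).2.1, hne, h⟩).elim h2
      fun h => h4 (tr (tr h3 h) h1)
  have a1 := fact h1 h2 h3 h4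
  have a2 := fact h3 h4 h1 h2
  have a3 : A u u' := by
    by_contra h
    have hne : u ≠ u' := by rintro rfl; exact h2 h3
    exact h2 (tr (hM.closed.1 _ _ _ h1 (hA _ _ a2) ⟨k1.1, k3.1, hne, h⟩) h3)
  have a4 : A x y := by
    by_contra h
    have hne : x ≠ y := by rintro rfl; exact h2 h1
    rcases hcov x y ⟨k1.2.1, k3.2.1, hne, h⟩ with h | h
    · exact h2 (tr h1 h)
    · exact h4 (tr h3 h)
  exact hT.noC4 u y x u' a1 (hA _ _ a4) (hA _ _ a2) (hA _ _ a3) k1 (k3.symm hA)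

/-- The point is that `leftEnd b ≤ rightEnd a` holds exactly when `a` does not precede `b`. Two
different vertices meet when neither precedes the other. -/
theorem IsPartialOrientation.isIntervalModel (hT : IsIntervalOrder A n T)
    (hM : IsPartialOrientation A n M) (hcov : ∀ x y, NonAdj A n x y → M x y ∨ M y x) :
    IsIntervalModel A n (leftEnd n M) (rightEnd n M) := by
  classical
  have hA := hT.symm
  have hr : ∀ a < n, ∀ q < n, q ≤ rightEnd n M a ↔ ∃ w < n, ¬ M a w ∧ q ≤ leftEnd n M w := by
    intro a ha q hq
    have h := @lt_card_filter_range_iff (Reaches n M a) (n + 1) (Reaches.mono a)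
    -- Position 0 is always reached, by `a` itself, so the truncated `- 1` in `rightEnd` really
    -- subtracts one.
    have h0 := (h (q := 0)).2 ⟨by omega, a, ha, fun h => hM.asymm _ _ h h, Nat.zero_le _⟩
    have hq' := h (q := q)
    rw [← and_iff_right (a := q < n + 1) (b := ∃ w < n, ¬ M a w ∧ q ≤ leftEnd n M w) (by omega)]
    refine Iff.trans ?_ hq'
    rw [rightEnd]
    omega
  have hlt : ∀ a < n, rightEnd n M a < n := by
    intro a ha
    by_contra! h
    have h' := @lt_card_filter_range_iff (Reaches n M a) (n + 1) (Reaches.mono a) n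
    obtain ⟨-, w, hw, -, h⟩ := h'.1 (by simp only [rightEnd] at h; omega)
    exact absurd (leftEnd_lt hM hw) (by omega)
  have hM' : ∀ a < n, ∀ b < n, leftEnd n M b ≤ rightEnd n M a ↔ ¬ M a b := by
    intro a ha b hb
    rw [hr a ha _ (leftEnd_lt hM hb)]
    refine ⟨?_, fun h => ⟨b, hb, h, le_rfl⟩⟩
    rintro ⟨w, hw, h1, h2⟩ h3
    -- Since `a` precedes `b` but not `w`, nestedness makes the predecessors of `w` a proper subset
    -- of those of `b`.
    refine absurd h2 (not_le.2 (Finset.card_lt_card ?_))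
    rw [Finset.ssubset_iff_of_subset]
    · exact ⟨a, by simp [ha, h3], by simp [h1]⟩
    · intro u hu
      simp only [Finset.mem_filter, Finset.mem_range] at hu ⊢
      by_contra h
      exact hM.pred_total hT hcov hu.2 (fun h' => h ⟨hu.1, h'⟩) h3 h1
  refine ⟨fun a ha => (hM' a ha a ha).2 fun h => hM.asymm _ _ h h, hlt, fun a ha b hb hab => ?_⟩
  rw [hM' a ha b hb, hM' b hb a ha]
  constructor
  · exact fun h => ⟨fun h' => (hM.sub _ _ h').2.2.2 (hA _ _ h), fun h' => (hM.sub _ _ h').2.2.2 h⟩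
  · rintro ⟨h1, h2⟩
    by_contra h
    exact (hcov a b ⟨ha, hb, hab, h⟩).elim h2 h1

end

/-! ### The dynamic program -/

/-- The state of the sweep, from right to left, for one color: the smallest left end of a vertex of
that color, and one more than the largest left end of a vertex that still lacks the color (`0` if
there is none). -/
abbrev ColorState : Type := ℕ × ℕ

/-- The change of the state of color `c` by a vertex with interval `[l, r]` and label `S`. -/
def ColorState.next (l r : ℕ) (S : Finset (Fin 2)) (c : Fin 2) (s : ColorState) : ColorState :=
  if S = ∅ then (if s.1 ≤ r then s else (s.1, max s.2 (l + 1)))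
  else if c ∈ S then (min s.1 l, if s.2 ≤ r + 1 then 0 else s.2) else s

/-- The states of both colors. -/
abbrev SweepState : Type := ColorState × ColorState

/-- The change of the state by a vertex with interval `[l, r]` and label `S`. -/
def SweepState.next (l r : ℕ) (S : Finset (Fin 2)) (σ : SweepState) : SweepState :=
  (σ.1.next l r S 0, σ.2.next l r S 1)

/-- The state reached by the labels `f` on the vertices `xs`. -/
def SweepState.run (l r : ℕ → ℕ) (f : ℕ → Finset (Fin 2)) : List ℕ → SweepState → SweepState
  | [], σ => σ
  | x :: xs, σ => SweepState.run l r f xs (σ.next (l x) (r x) (f x))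

/-- The penalty of a final state: `0` if no vertex lacks a color. -/
def SweepState.penalty (big : ℕ) (σ : SweepState) : ℕ := if σ.1.2 + σ.2.2 = 0 then 0 else big

/-- The least cost of labels for the vertices `xs`, including the penalty. -/
def SweepState.value (big : ℕ) (l r : ℕ → ℕ) : List ℕ → SweepState → ℕ
  | [], σ => σ.penalty big
  | x :: xs, σ =>
    min (min (SweepState.value big l r xs (σ.next (l x) (r x) ∅))
        (1 + SweepState.value big l r xs (σ.next (l x) (r x) {0})))
      (min (1 + SweepState.value big l r xs (σ.next (l x) (r x) {1}))
        (2 + SweepState.value big l r xs (σ.next (l x) (r x) {0, 1})))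

theorem SweepState.value_cons_le (big : ℕ) (l r : ℕ → ℕ) (x : ℕ) (xs : List ℕ) (σ : SweepState)
    (S : Finset (Fin 2)) :
    SweepState.value big l r (x :: xs) σ ≤
      S.card + SweepState.value big l r xs (σ.next (l x) (r x) S) := by
  have : S = ∅ ∨ S = {0} ∨ S = {1} ∨ S = {0, 1} := by revert S; decide
  rcases this with rfl | rfl | rfl | rfl <;> simp [SweepState.value]

theorem SweepState.exists_value_cons (big : ℕ) (l r : ℕ → ℕ) (x : ℕ) (xs : List ℕ)
    (σ : SweepState) : ∃ S : Finset (Fin 2), SweepState.value big l r (x :: xs) σ =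
      S.card + SweepState.value big l r xs (σ.next (l x) (r x) S) := by
  rw [SweepState.value]
  generalize hA : SweepState.value big l r xs (σ.next (l x) (r x) ∅) = a
  generalize hB : SweepState.value big l r xs (σ.next (l x) (r x) {0}) = b
  generalize hC : SweepState.value big l r xs (σ.next (l x) (r x) {1}) = c
  generalize hD : SweepState.value big l r xs (σ.next (l x) (r x) {0, 1}) = d
  have : min (min a (1 + b)) (min (1 + c) (2 + d)) = a ∨
      min (min a (1 + b)) (min (1 + c) (2 + d)) = 1 + b ∨
      min (min a (1 + b)) (min (1 + c) (2 + d)) = 1 + c ∨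
      min (min a (1 + b)) (min (1 + c) (2 + d)) = 2 + d := by omega
  rcases this with h | h | h | h <;> rw [h]
  · exact ⟨∅, by simp [hA]⟩
  · exact ⟨{0}, by simp [hB]⟩
  · exact ⟨{1}, by simp [hC]⟩
  · exact ⟨{0, 1}, by simp [hD]⟩

theorem SweepState.value_le (big : ℕ) (l r : ℕ → ℕ) (f : ℕ → Finset (Fin 2)) (xs : List ℕ)
    (σ : SweepState) : SweepState.value big l r xs σ ≤
      (xs.map fun x => (f x).card).sum + (SweepState.run l r f xs σ).penalty big := by
  induction xs generalizing σ with
  | nil => simp [SweepState.value, SweepState.run]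
  | cons x xs ih =>
    refine (SweepState.value_cons_le big l r x xs σ (f x)).trans ?_
    rw [List.map_cons, List.sum_cons, add_assoc]
    exact Nat.add_le_add_left (ih _) _

theorem SweepState.run_congr (l r : ℕ → ℕ) {f g : ℕ → Finset (Fin 2)} {xs : List ℕ}
    (h : ∀ x ∈ xs, f x = g x) (σ : SweepState) :
    SweepState.run l r f xs σ = SweepState.run l r g xs σ := by
  induction xs generalizing σ with
  | nil => rfl
  | cons x xs ih =>
    rw [SweepState.run, SweepState.run, h x (by simp), ih fun y hy => h y (by simp [hy])]

theorem SweepState.exists_value_eq (big : ℕ) (l r : ℕ → ℕ) {xs : List ℕ} (hxs : xs.Nodup)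
    (σ : SweepState) : ∃ f : ℕ → Finset (Fin 2), SweepState.value big l r xs σ =
      (xs.map fun x => (f x).card).sum + (SweepState.run l r f xs σ).penalty big := by
  induction xs generalizing σ with
  | nil => exact ⟨fun _ => ∅, by simp [SweepState.value, SweepState.run]⟩
  | cons x xs ih =>
    obtain ⟨hx, hxs⟩ := List.nodup_cons.1 hxs
    obtain ⟨S, hS⟩ := SweepState.exists_value_cons big l r x xs σ
    obtain ⟨f, hf⟩ := ih hxs (σ.next (l x) (r x) S)
    have hne : ∀ y ∈ xs, Function.update f x S y = f y := by
      intro y hy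
      exact Function.update_of_ne (by rintro rfl; exact hx hy) _ _
    refine ⟨Function.update f x S, ?_⟩
    have hmap : xs.map (fun y => (Function.update f x S y).card) = xs.map fun y => (f y).card :=
      List.map_congr_left fun y hy => by rw [hne y hy]
    rw [hS, hf, List.map_cons, List.sum_cons, SweepState.run, SweepState.run_congr l r hne,
      Function.update_self, add_assoc, hmap]

/-! ### The sweep state determines feasibility -/

section

variable {A : ℕ → ℕ → Prop} {n : ℕ} {l r : ℕ → ℕ}

/-- The state of color `c` describes the labels `f` on the vertices `Y`. -/
def ColorState.Describes (A : ℕ → ℕ → Prop) (n : ℕ) (l : ℕ → ℕ) (f : ℕ → Finset (Fin 2))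
    (c : Fin 2) (Y : Set ℕ) (s : ColorState) : Prop :=
  (∀ q < n, s.1 ≤ q ↔ ∃ u ∈ Y, c ∈ f u ∧ l u ≤ q) ∧
    ∀ q, s.2 ≤ q ↔ ∀ v ∈ Y, f v = ∅ → (∀ u ∈ Y, c ∈ f u → ¬ A v u) → l v + 1 ≤ q

/-- All vertices of `Y` have right ends at least `r x`, so `y ∈ Y` is adjacent to `x` iff `l y ≤ r
x`. An unlabeled `x` therefore sees the color iff the least left end of that color is at most `r x`,
and a colored `x` serves exactly the lacking vertices with left end at most `r x`. The two extremal
values decide both questions. -/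
theorem ColorState.Describes.next (hm : IsIntervalModel A n l r) {f : ℕ → Finset (Fin 2)}
    {c : Fin 2} {Y : Set ℕ} {s : ColorState} (hs : s.Describes A n l f c Y) {x : ℕ} (hx : x < n)
    (hY : ∀ y ∈ Y, y < n ∧ r x ≤ r y ∧ y ≠ x) :
    (s.next (l x) (r x) (f x) c).Describes A n l f c (insert x Y) := by
  obtain ⟨h1, h2⟩ := hs
  have hxx := hm.le x hx
  have hrx := hm.lt x hx
  have hadj : ∀ y ∈ Y, (A y x ↔ l y ≤ r x) := by
    intro y hy
    obtain ⟨a1, a2, a3⟩ := hY y hy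
    rw [hm.adj_iff y a1 x hx a3, and_iff_left (hxx.trans a2)]
  have hadj' : ∀ y ∈ Y, (A x y ↔ l y ≤ r x) := by
    intro y hy
    obtain ⟨a1, a2, a3⟩ := hY y hy
    rw [hm.adj_iff x hx y a1 a3.symm, and_iff_right (hxx.trans a2)]
  by_cases hf : f x = ∅
  · have hL : ∀ q < n, s.1 ≤ q ↔ ∃ u ∈ insert x Y, c ∈ f u ∧ l u ≤ q := by
      intro q hq
      rw [h1 q hq]
      constructor
      · rintro ⟨u, hu, h⟩; exact ⟨u, .inr hu, h⟩
      · rintro ⟨u, rfl | hu, h⟩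
        · simp [hf] at h
        · exact ⟨u, hu, h⟩
    have hxp : (∀ u ∈ Y, c ∈ f u → ¬ A x u) ↔ ¬ s.1 ≤ r x := by
      rw [h1 _ hrx]
      push Not
      exact forall_congr' fun u => forall_congr' fun hu => forall_congr' fun _ => by
        rw [hadj' u hu, not_le]
    rw [ColorState.next, if_pos hf]
    split_ifs with hle
    · refine ⟨hL, fun q => ?_⟩
      simp only [Set.forall_mem_insert, hf, Finset.notMem_empty, hxp, hle, not_true_eq_false,
        false_imp_iff, imp_true_iff, true_and]
      exact h2 q
    · refine ⟨hL, fun q => ?_⟩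
      simp only [Set.forall_mem_insert, hf, Finset.notMem_empty, hxp, hle, not_false_eq_true,
        false_imp_iff, true_imp_iff, true_and, max_le_iff, h2 q]
      exact and_comm
  · rw [ColorState.next, if_neg hf]
    by_cases hc : c ∈ f x
    · rw [if_pos hc]
      refine ⟨fun q hq => ?_, fun q => ?_⟩
      · rw [min_le_iff, h1 q hq]
        constructor
        · rintro (⟨u, hu, h⟩ | h)
          · exact ⟨u, .inr hu, h⟩
          · exact ⟨x, .inl rfl, hc, h⟩
        · rintro ⟨u, rfl | hu, h⟩
          · exact .inr h.2
          · exact .inl ⟨u, hu, h⟩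
      · simp only [Set.forall_mem_insert, hf, false_imp_iff, true_and, hc, forall_const]
        split_ifs with hle
        · refine ⟨fun _ v hv h3 ⟨h4, h5⟩ => ?_, fun _ => Nat.zero_le _⟩
          rw [hadj v hv] at h4
          have := (h2 _).1 hle v hv h3 h5
          omega
        · constructor
          · exact fun h v hv h3 h4 => (h2 q).1 h v hv h3 h4.2
          · intro h
            -- The state is not reset, so some lacking vertex has left end beyond `r x`. It still
            -- lacks the color and determines the maximum, whichever vertices with smaller left ends
            -- `x` has served.
            have hq : r x + 1 ≤ q := by
              by_contra hlt
              refine hle ((h2 _).2 fun v hv h3 h4 => ?_)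
              by_contra h5
              have := h v hv h3 ⟨by rw [hadj v hv]; omega, h4⟩
              omega
            refine (h2 q).2 fun v hv h3 h4 => ?_
            by_cases h5 : l v ≤ r x
            · omega
            · exact h v hv h3 ⟨by rwa [hadj v hv], h4⟩
    · rw [if_neg hc]
      refine ⟨fun q hq => ?_, fun q => ?_⟩
      · rw [h1 q hq]
        constructor
        · rintro ⟨u, hu, h⟩; exact ⟨u, .inr hu, h⟩
        · rintro ⟨u, rfl | hu, h⟩
          · exact absurd h.1 hc
          · exact ⟨u, hu, h⟩
      · simp only [Set.forall_mem_insert, hf, false_imp_iff, true_and, hc]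
        exact h2 q

theorem SweepState.run_describes (hm : IsIntervalModel A n l r) {f : ℕ → Finset (Fin 2)}
    (xs : List ℕ) {Y : Set ℕ} {σ : SweepState} (h0 : σ.1.Describes A n l f 0 Y)
    (h1 : σ.2.Describes A n l f 1 Y) (hxs : xs.Pairwise fun x y => r y ≤ r x) (hnd : xs.Nodup)
    (hlt : ∀ x ∈ xs, x < n) (hY : ∀ y ∈ Y, y < n ∧ ∀ x ∈ xs, r x ≤ r y ∧ y ≠ x) :
    (SweepState.run l r f xs σ).1.Describes A n l f 0 (Y ∪ {x | x ∈ xs}) ∧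
      (SweepState.run l r f xs σ).2.Describes A n l f 1 (Y ∪ {x | x ∈ xs}) := by
  induction xs generalizing Y σ with
  | nil => simpa [SweepState.run] using ⟨h0, h1⟩
  | cons x xs ih =>
    obtain ⟨h2, h3⟩ := List.pairwise_cons.1 hxs
    obtain ⟨h4, h5⟩ := List.nodup_cons.1 hnd
    have hx := hlt x (by simp)
    have hY' : ∀ y ∈ Y, y < n ∧ r x ≤ r y ∧ y ≠ x :=
      fun y hy => ⟨(hY y hy).1, (hY y hy).2 x (by simp)⟩
    have := ih (Y := insert x Y) (σ := σ.next (l x) (r x) (f x)) (h0.next hm hx hY')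
      (h1.next hm hx hY') h3 h5 (fun y hy => hlt y (by simp [hy])) (by
      rintro y (rfl | hy)
      · exact ⟨hx, fun z hz => ⟨h2 z hz, by rintro rfl; exact h4 hz⟩⟩
      · exact ⟨(hY y hy).1, fun z hz => (hY y hy).2 z (by simp [hz])⟩)
    have e : insert x Y ∪ {y | y ∈ xs} = Y ∪ {y | y ∈ x :: xs} := by
      ext y; simp only [Set.mem_union, Set.mem_insert_iff, Set.mem_ofPred_eq, List.mem_cons]; tauto
    rw [e] at this
    exact this

/-- The labels are a rainbow function on the graph `A` with vertices below `n`. -/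
def IsRainbowBelow (A : ℕ → ℕ → Prop) (n : ℕ) (f : ℕ → Finset (Fin 2)) : Prop :=
  ∀ v < n, f v = ∅ → ∀ c, ∃ u < n, A v u ∧ c ∈ f u

/-- After all vertices have been swept, the second component for each color is 0 iff no unlabeled
vertex lacks that color. -/
theorem SweepState.run_penalty (hm : IsIntervalModel A n l r) (f : ℕ → Finset (Fin 2))
    {xs : List ℕ} (hxs : xs.Pairwise fun x y => r y ≤ r x) (hnd : xs.Nodup)
    (hmem : ∀ x, x ∈ xs ↔ x < n) (big : ℕ) [Decidable (IsRainbowBelow A n f)] :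
    (SweepState.run l r f xs ((n, 0), (n, 0))).penalty big =
      if IsRainbowBelow A n f then 0 else big := by
  -- The value `n` stands for the absence of a colored vertex: the description tests only positions
  -- below `n`.
  have h0 : ∀ c, ColorState.Describes A n l f c ∅ (n, 0) := by
    intro c
    exact ⟨fun q hq => by simpa using hq, fun q => by simp⟩
  obtain ⟨h1, h2⟩ := SweepState.run_describes hm xs (σ := ((n, 0), (n, 0))) (h0 0) (h0 1) hxs hnd
    (fun x hx => (hmem x).1 hx) (by simp)
  set τ := SweepState.run l r f xs ((n, 0), (n, 0))
  have h3 := h1.2 0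
  have h4 := h2.2 0
  simp only [hmem, Set.empty_union, Set.mem_ofPred_eq, Nat.le_zero, Nat.succ_ne_zero, imp_false,
    not_forall, not_not, exists_prop] at h3 h4
  rw [SweepState.penalty]
  congr 1
  rw [Nat.add_eq_zero_iff, h3, h4, IsRainbowBelow, eq_iff_iff]
  constructor
  · rintro ⟨h5, h6⟩ v hv hf c
    fin_cases c
    · obtain ⟨u, a, b, d⟩ := h5 v hv hf
      exact ⟨u, a, d, b⟩
    · obtain ⟨u, a, b, d⟩ := h6 v hv hf
      exact ⟨u, a, d, b⟩
  · intro h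
    constructor <;> intro v hv hf
    · obtain ⟨u, a, b, d⟩ := h v hv hf 0
      exact ⟨u, a, d, b⟩
    · obtain ⟨u, a, b, d⟩ := h v hv hf 1
      exact ⟨u, a, d, b⟩

/-- The adjacency relation of a graph on `Fin n` as a relation on the natural numbers. -/
def natAdj {n : ℕ} (G : SimpleGraph (Fin n)) (a b : ℕ) : Prop :=
  ∃ (ha : a < n) (hb : b < n), G.Adj ⟨a, ha⟩ ⟨b, hb⟩

theorem isRainbowFunction_iff (G : SimpleGraph (Fin n)) (f : ℕ → Finset (Fin 2)) :
    IsRainbowFunction 2 G (fun x => f x) ↔ IsRainbowBelow (natAdj G) n f := by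
  constructor
  · intro h v hv hf c
    obtain ⟨y, h1, h2⟩ := h ⟨v, hv⟩ hf c
    exact ⟨y, y.2, ⟨hv, y.2, h1⟩, h2⟩
  · intro h x hf c
    obtain ⟨u, hu, ⟨_, _, h1⟩, h2⟩ := h x x.2 hf c
    exact ⟨⟨u, hu⟩, h1, h2⟩

/-- The dynamic program computes the `2`-rainbow domination number. -/
theorem SweepState.value_eq_rainbowDominationNumber (G : SimpleGraph (Fin n))
    (hm : IsIntervalModel (natAdj G) n l r) {xs : List ℕ}
    (hxs : xs.Pairwise fun x y => r y ≤ r x) (hnd : xs.Nodup) (hmem : ∀ x, x ∈ xs ↔ x < n)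
    {big : ℕ} (hbig : 2 * n < big) :
    SweepState.value big l r xs ((n, 0), (n, 0)) = rainbowDominationNumber 2 G := by
  classical
  have hperm : xs.Perm (List.range n) :=
    (List.perm_ext_iff_of_nodup hnd List.nodup_range).2 (by simp [hmem])
  have hcost : ∀ f : ℕ → Finset (Fin 2), (xs.map fun x => (f x).card).sum =
      rainbowCost fun x : Fin n => f x := by
    intro f
    rw [(hperm.map _).sum_eq, rainbowCost, ← Finset.sum_range fun i => (f i).card]
    rfl
  have hle : ∀ f : ℕ → Finset (Fin 2), IsRainbowFunction 2 G (fun x => f x) →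
      SweepState.value big l r xs ((n, 0), (n, 0)) ≤ rainbowCost fun x : Fin n => f x := by
    intro f hf
    have := SweepState.value_le big l r f xs ((n, 0), (n, 0))
    rwa [SweepState.run_penalty hm f hxs hnd hmem, if_pos ((isRainbowFunction_iff G f).1 hf),
      hcost, add_zero] at this
  apply le_antisymm
  · obtain ⟨f, hf, hc⟩ := exists_rainbowFunction_cost_eq 2 G
    have := hle (fun v => if h : v < n then f ⟨v, h⟩ else ∅) (by simpa using hf)
    rw [← hc]
    simpa using this
  · obtain ⟨f, hf⟩ := SweepState.exists_value_eq big l r hnd ((n, 0), (n, 0))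
    rw [SweepState.run_penalty hm f hxs hnd hmem, hcost] at hf
    by_cases h : IsRainbowBelow (natAdj G) n f
    · rw [hf, if_pos h, add_zero]
      exact Nat.sInf_le ⟨_, (isRainbowFunction_iff G f).2 h, rfl⟩
    -- Labeling every vertex with both colors is feasible and costs `2 * n < big`, so an optimal
    -- labeling avoids the penalty.
    · have h2 := hle (fun _ => Finset.univ) fun x hx =>
        absurd hx Finset.univ_nonempty.ne_empty
      rw [hf, if_neg h] at h2
      have : rainbowCost (fun _ : Fin n => (Finset.univ : Finset (Fin 2))) = n * 2 := by
        simp [rainbowCost]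
      omega

end

/-! ### The program -/

/-! ### Derived operations and truth values -/

namespace Ex

/-- Truth value of `a < b`. -/
def lt (a b : Ex) : Ex := .sub b a

/-- Logical negation. -/
def not (a : Ex) : Ex := .ite a (.num 0) (.num 1)

/-- Logical conjunction. -/
def and (a b : Ex) : Ex := .ite a b (.num 0)

/-- Truth value of `a = b`. -/
def eq (a b : Ex) : Ex := not (.add (.sub a b) (.sub b a))

/-- Minimum. -/
def min (a b : Ex) : Ex := .sub a (.sub a b)

/-- Maximum. -/
def max (a b : Ex) : Ex := .add a (.sub b a)

/-- The index of entry `(a, b)` of an `N × N` table. -/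
def pair (a b : Ex) : Ex := .add (.mulN a) b

/-- The number of vertices. -/
def size : Ex := .sub .len (.num 1)

variable (w : List ℕ) (N : ℕ) (T : Tables) (v : ℕ) (ρ : ℕ → ℕ) (a b : Ex)

theorem eval_lt : (lt a b).eval w N T v ρ ≠ 0 ↔ a.eval w N T v ρ < b.eval w N T v ρ := by
  simp only [lt, eval]; omega

theorem eval_not : (not a).eval w N T v ρ ≠ 0 ↔ ¬ a.eval w N T v ρ ≠ 0 := by
  simp only [not, eval]; split_ifs <;> simp_all

theorem eval_and : (and a b).eval w N T v ρ ≠ 0 ↔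
    a.eval w N T v ρ ≠ 0 ∧ b.eval w N T v ρ ≠ 0 := by
  simp only [and, eval]; split_ifs <;> simp_all

theorem eval_add : (add a b).eval w N T v ρ ≠ 0 ↔
    a.eval w N T v ρ ≠ 0 ∨ b.eval w N T v ρ ≠ 0 := by
  simp only [eval]; omega

theorem eval_eq : (eq a b).eval w N T v ρ ≠ 0 ↔ a.eval w N T v ρ = b.eval w N T v ρ := by
  rw [eq, eval_not, eval, eval, eval]; omega

theorem eval_min : (min a b).eval w N T v ρ = Min.min (a.eval w N T v ρ) (b.eval w N T v ρ) := by
  simp only [min, eval]; omega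

theorem eval_max : (max a b).eval w N T v ρ = Max.max (a.eval w N T v ρ) (b.eval w N T v ρ) := by
  simp only [max, eval]; omega

theorem eval_pair : (pair a b).eval w N T v ρ = a.eval w N T v ρ * N + b.eval w N T v ρ := rfl

theorem eval_sum : (sum a).eval w N T v ρ ≠ 0 ↔
    ∃ i < N, a.eval w N T (v + 1) (Function.update ρ v i) ≠ 0 := by
  simp [eval]

theorem eval_ite (c : Ex) : (ite c a b).eval w N T v ρ =
    if c.eval w N T v ρ ≠ 0 then a.eval w N T v ρ else b.eval w N T v ρ := by
  rw [eval, ite_not]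

theorem eval_entry {i j : ℕ} (k : Fin 8) (hi : i < v) (hj : j < v) :
    (tab k (pair (var i) (var j))).eval w N T v ρ = T k (ρ i * N + ρ j) := by
  simp [eval, pair, hi, hj]

end Ex

/-! ### Filling tables by nested loops -/

/-- `T'` arises from `T` by writing `g i` to some entries `i` of table `k`, among them those with
`i ∈ S`. -/
def Fills (k : Fin 8) (g : ℕ → ℕ) (S : Set ℕ) (T T' : Tables) : Prop :=
  (∀ j ≠ k, T' j = T j) ∧ (∀ i ∈ S, T' k i = g i) ∧ ∀ i, T' k i = T k i ∨ T' k i = g i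

/-- All writes to an entry agree on its value `g i`, so later rounds cannot spoil earlier ones. The
fixed `T₀` records that tables other than `k` stay unchanged, which suffices for values computed
without reading table `k`. -/
theorem Fills.iter {k : Fin 8} {g : ℕ → ℕ} {S : ℕ → Set ℕ} {T₀ T : Tables} {N : ℕ}
    {F : ℕ → Tables → Tables} (hT : ∀ j ≠ k, T j = T₀ j)
    (hF : ∀ i < N, ∀ T, (∀ j ≠ k, T j = T₀ j) → Fills k g (S i) T (F i T)) :
    Fills k g {x | ∃ i < N, x ∈ S i} T (iter F N T) := by
  have key : ∀ m ≤ N, Fills k g {x | ∃ i < m, x ∈ S i} T (_root_.iter F m T) := by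
    intro m
    induction m with
    | zero => exact fun _ => ⟨fun _ _ => rfl, fun i ⟨_, h, _⟩ => absurd h (Nat.not_lt_zero _),
        fun i => .inl rfl⟩
    | succ m ih =>
      intro hm
      obtain ⟨h1, h2, h3⟩ := ih (by omega)
      obtain ⟨h4, h5, h6⟩ := hF m hm (_root_.iter F m T) fun j hj => (h1 j hj).trans (hT j hj)
      refine ⟨fun j hj => (h4 j hj).trans (h1 j hj), ?_, fun i => ?_⟩
      · rintro i ⟨x, hx, hi⟩
        rcases Nat.lt_succ_iff_lt_or_eq.1 hx with hx | rfl
        · rcases h6 i with h | h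
          · exact h.trans (h2 i ⟨x, hx, hi⟩)
          · exact h
        · exact h5 i hi
      · rcases h6 i with h | h
        · rcases h3 i with h' | h'
          exacts [.inl (h.trans h'), .inr (h.trans h')]
        · exact .inr h
  exact key N le_rfl

theorem Fills.store {w : List ℕ} {N v : ℕ} {ρ : ℕ → ℕ} {k : Fin 8} {a e : Ex} {g : ℕ → ℕ}
    {T : Tables} {i : ℕ} (hi : a.eval w N T v ρ = i) (h : e.eval w N T v ρ = g i) :
    Fills k g {i} T ((Stmt.store k a e).exec w N v ρ T) := by
  refine ⟨fun j hj => Function.update_of_ne hj _ _, ?_, fun i' => ?_⟩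
  · rintro _ rfl
    simp [Stmt.exec, h, hi]
  · by_cases hi' : i' = i
    · right; subst hi'; simp [Stmt.exec, h, hi]
    · left; simp [Stmt.exec, hi, hi']

theorem pair_div {a b N : ℕ} (hb : b < N) : (a * N + b) / N = a := by
  rw [mul_comm, Nat.mul_add_div (by omega), Nat.div_eq_of_lt hb, add_zero]

theorem pair_mod {a b N : ℕ} (hb : b < N) : (a * N + b) % N = b := by
  rw [Nat.mul_add_mod', Nat.mod_eq_of_lt hb]

/-- Assign `e` to all entries of a table with one index. -/
def fill1 (k : Fin 8) (v : ℕ) (e : Ex) : Stmt := .loop (.store k (.var v) e)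

/-- Assign `e` to all entries of a table with two indices. -/
def fill2 (k : Fin 8) (v : ℕ) (e : Ex) : Stmt :=
  .loop (.loop (.store k (.pair (.var v) (.var (v + 1))) e))

/-- The index of entry `(a, b, c, d)` of a table with four indices. -/
def Ex.quad (a b c d : Ex) : Ex := .pair (.pair (.pair a b) c) d

/-- Assign `e` to all entries of a table with four indices. -/
def fill4 (k : Fin 8) (v : ℕ) (e : Ex) : Stmt :=
  .loop (.loop (.loop (.loop
    (.store k (.quad (.var v) (.var (v + 1)) (.var (v + 2)) (.var (v + 3))) e))))

/-- The variables `v, …` are set to the given values. -/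
def setVars (ρ : ℕ → ℕ) : ℕ → List ℕ → ℕ → ℕ
  | _, [] => ρ
  | v, x :: xs => setVars (Function.update ρ v x) (v + 1) xs

theorem exec_fill1 {w : List ℕ} {N v : ℕ} {ρ : ℕ → ℕ} {k : Fin 8} {e : Ex} {g : ℕ → ℕ}
    {T : Tables} (h : ∀ T' : Tables, (∀ j ≠ k, T' j = T j) → ∀ a < N,
      e.eval w N T' (v + 1) (setVars ρ v [a]) = g a) :
    (∀ j ≠ k, (fill1 k v e).exec w N v ρ T j = T j) ∧
      ∀ a < N, (fill1 k v e).exec w N v ρ T k a = g a := by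
  have := Fills.iter (k := k) (g := g) (S := fun i => {i}) (T₀ := T) (T := T) (N := N)
    (F := fun i => (Stmt.store k (.var v) e).exec w N (v + 1) (Function.update ρ v i))
    (fun _ _ => rfl) fun i hi T' hT' => Fills.store (by simp [Ex.eval]) (h T' hT' i hi)
  exact ⟨this.1, fun a ha => this.2.1 a ⟨a, ha, rfl⟩⟩

theorem exec_fill2 {w : List ℕ} {N v : ℕ} {ρ : ℕ → ℕ} {k : Fin 8} {e : Ex} {g : ℕ → ℕ → ℕ}
    {T : Tables} (h : ∀ T' : Tables, (∀ j ≠ k, T' j = T j) → ∀ a < N, ∀ b < N,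
      e.eval w N T' (v + 2) (setVars ρ v [a, b]) = g a b) :
    (∀ j ≠ k, (fill2 k v e).exec w N v ρ T j = T j) ∧
      ∀ a < N, ∀ b < N, (fill2 k v e).exec w N v ρ T k (a * N + b) = g a b := by
  have := Fills.iter (k := k) (g := fun i => g (i / N) (i % N))
    (S := fun a => {x | ∃ b < N, x ∈ ({a * N + b} : Set ℕ)}) (T₀ := T) (T := T) (N := N)
    (F := fun a => (Stmt.loop (.store k (.pair (.var v) (.var (v + 1))) e)).exec w N (v + 1)
      (Function.update ρ v a)) (fun _ _ => rfl) fun a ha T' hT' =>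
      Fills.iter (T₀ := T) hT' fun b hb T' hT' => Fills.store
        (by simp [Ex.eval, Ex.pair]) (by
          rw [pair_div hb, pair_mod hb]; exact h T' hT' a ha b hb)
  refine ⟨this.1, fun a ha b hb => ?_⟩
  have h1 := this.2.1 (a * N + b) ⟨a, ha, b, hb, rfl⟩
  simp only [pair_div hb, pair_mod hb] at h1
  exact h1

theorem exec_fill4 {w : List ℕ} {N v : ℕ} {ρ : ℕ → ℕ} {k : Fin 8} {e : Ex}
    {g : ℕ → ℕ → ℕ → ℕ → ℕ} {T : Tables}
    (h : ∀ T' : Tables, (∀ j ≠ k, T' j = T j) → ∀ a < N, ∀ b < N, ∀ c < N, ∀ d < N,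
      e.eval w N T' (v + 4) (setVars ρ v [a, b, c, d]) = g a b c d) :
    (∀ j ≠ k, (fill4 k v e).exec w N v ρ T j = T j) ∧
      ∀ a < N, ∀ b < N, ∀ c < N, ∀ d < N,
        (fill4 k v e).exec w N v ρ T k (((a * N + b) * N + c) * N + d) = g a b c d := by
  have := Fills.iter (k := k)
    (g := fun i => g (i / N / N / N) (i / N / N % N) (i / N % N) (i % N))
    (S := fun a => {x | ∃ b < N, x ∈ {x | ∃ c < N, x ∈ {x | ∃ d < N,
      x ∈ ({((a * N + b) * N + c) * N + d} : Set ℕ)}}}) (T₀ := T) (T := T) (N := N)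
    (F := fun a => (Stmt.loop (.loop (.loop (.store k (.quad (.var v) (.var (v + 1))
      (.var (v + 2)) (.var (v + 3))) e)))).exec w N (v + 1)
      (Function.update ρ v a)) (fun _ _ => rfl) fun a ha T' hT' =>
      Fills.iter (T₀ := T) hT' fun b hb T' hT' => Fills.iter (T₀ := T) hT' fun c hc T' hT' =>
        Fills.iter (T₀ := T) hT' fun d hd T' hT' => Fills.store
          (by
            simp [Ex.eval, Ex.pair, Ex.quad, Function.update]
            split_ifs <;> omega) (by
            simp only [pair_div hb, pair_mod hb, pair_div hc, pair_mod hc, pair_div hd, pair_mod hd]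
            exact h T' hT' a ha b hb c hc d hd)
  refine ⟨this.1, fun a ha b hb c hc d hd => ?_⟩
  have h1 := this.2.1 (((a * N + b) * N + c) * N + d) ⟨a, ha, b, hb, c, hc, d, hd, rfl⟩
  simp only [pair_div hb, pair_mod hb, pair_div hc, pair_mod hc, pair_div hd, pair_mod hd] at h1
  exact h1

/-! ### Computing the orientation by closure under forcing -/

/-- The pairs `(a, b)` with a nonzero entry in table `k`. -/
def relOf (N : ℕ) (k : Fin 8) (T : Tables) (a b : ℕ) : Prop := a < N ∧ b < N ∧ T k (a * N + b) ≠ 0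

/-- Tables `0` and `1` hold the adjacent and the nonadjacent pairs. -/
def HasGraph (A : ℕ → ℕ → Prop) (n : ℕ) (T : Tables) : Prop :=
  ∀ a < n + 1, ∀ b < n + 1, (T 0 (a * (n + 1) + b) ≠ 0 ↔ A a b) ∧
    (T 1 (a * (n + 1) + b) ≠ 0 ↔ NonAdj A n a b)

/-- `M'` arises from `M` by adding some forced pairs, among them those that are directly forced. -/
def ForceStep (A : ℕ → ℕ → Prop) (n : ℕ) (M M' : ℕ → ℕ → Prop) : Prop :=
  (∀ a b, M a b → M' a b) ∧
  (∀ a b c, NonAdj A n a b → M a c ∧ A c b ∨ M c b ∧ A c a → M' a b) ∧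
  ∀ Q, ForceClosed A n Q → (∀ a b, M a b → Q a b) → ∀ a b, M' a b → Q a b

/-- A sequence of `k` steps. -/
inductive ForceSteps (A : ℕ → ℕ → Prop) (n : ℕ) (M : ℕ → ℕ → Prop) : ℕ → (ℕ → ℕ → Prop) → Prop
  | zero : ForceSteps A n M 0 M
  | succ {k : ℕ} {M' M'' : ℕ → ℕ → Prop} :
      ForceSteps A n M k M' → ForceStep A n M' M'' → ForceSteps A n M (k + 1) M''

theorem ForceSteps.append {A : ℕ → ℕ → Prop} {n k k' : ℕ} {M M' M'' : ℕ → ℕ → Prop}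
    (h : ForceSteps A n M k M') (h' : ForceSteps A n M' k' M'') :
    ForceSteps A n M (k + k') M'' := by
  induction h' with
  | zero => exact h
  | succ _ hs ih => exact ih.succ hs

theorem ForceSteps.sub {A : ℕ → ℕ → Prop} {n k : ℕ} {M M' : ℕ → ℕ → Prop}
    (h : ForceSteps A n M k M') : ∀ a b, M a b → M' a b := by
  induction h with
  | zero => exact fun _ _ h => h
  | succ _ hs ih => exact fun a b h => hs.1 _ _ (ih a b h)

theorem ForceSteps.sub_closed {A : ℕ → ℕ → Prop} {n k : ℕ} {M M' Q : ℕ → ℕ → Prop}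
    (h : ForceSteps A n M k M') (hQ : ForceClosed A n Q) (hMQ : ∀ a b, M a b → Q a b) :
    ∀ a b, M' a b → Q a b := by
  induction h with
  | zero => exact hMQ
  | succ _ hs ih => exact hs.2.2 _ hQ ih

theorem ForceStep.closed_of_eq {A : ℕ → ℕ → Prop} {n : ℕ} {M : ℕ → ℕ → Prop}
    (h : ForceStep A n M M) : ForceClosed A n M :=
  ⟨fun a b c h1 h2 h3 => h.2.1 a c b h3 (.inl ⟨h1, h2⟩),
    fun a b c h1 h2 h3 => h.2.1 c b a h3 (.inr ⟨h1, h2⟩)⟩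

theorem forceClosed_nonAdj (A : ℕ → ℕ → Prop) (n : ℕ) : ForceClosed A n (NonAdj A n) :=
  ⟨fun _ _ _ _ _ h => h, fun _ _ _ _ _ h => h⟩

/-- A step that adds no pair shows that the relation is closed, and a closed relation no longer
changes. Until then every step adds at least one pair. -/
theorem ForceSteps.closed_or_le_ncard {A : ℕ → ℕ → Prop} {n k : ℕ} {M M' : ℕ → ℕ → Prop}
    (hM : ∀ a b, M a b → NonAdj A n a b)
    (h : ForceSteps A n M k M') : ForceClosed A n M' ∨ k ≤ {e : ℕ × ℕ | M' e.1 e.2}.ncard := by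
  induction h with
  | zero => exact .inr (Nat.zero_le _)
  | @succ k M' M'' h hs ih =>
    have hM'' := (h.succ hs).sub_closed (forceClosed_nonAdj A n) hM
    have hext : ∀ {M₁ M₂ : ℕ → ℕ → Prop}, (∀ a b, M₁ a b → M₂ a b) → (∀ a b, M₂ a b → M₁ a b) →
        M₁ = M₂ := fun h1 h2 => by
      funext a b; exact propext ⟨h1 a b, h2 a b⟩
    rcases ih with ih | ih
    · left
      rwa [hext (hs.2.2 _ ih fun _ _ h => h) hs.1]
    · by_cases heq : ∀ a b, M'' a b → M' a b
      · left
        obtain rfl := hext heq hs.1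
        exact hs.closed_of_eq
      · right
        refine ih.trans_lt (Set.ncard_lt_ncard ⟨fun e he => hs.1 _ _ he, fun h =>
          heq fun a b hab => @h (a, b) hab⟩ ?_)
        refine ((Finset.range n ×ˢ Finset.range n).finite_toSet).subset fun e he => ?_
        have := hM'' _ _ he
        simpa using ⟨this.1, this.2.1⟩

theorem ForceSteps.closed {A : ℕ → ℕ → Prop} {n : ℕ} {M M' : ℕ → ℕ → Prop}
    (hM : ∀ a b, M a b → NonAdj A n a b)
    (h : ForceSteps A n M ((n + 1) * (n + 1)) M') : ForceClosed A n M' := by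
  refine (h.closed_or_le_ncard hM).resolve_right fun hle => ?_
  have hsub : {e : ℕ × ℕ | M' e.1 e.2} ⊆ (Finset.range n ×ˢ Finset.range n : Finset (ℕ × ℕ)) := by
    intro e he
    have := h.sub_closed (forceClosed_nonAdj A n) hM _ _ he
    simpa using ⟨this.1, this.2.1⟩
  have := Set.ncard_le_ncard hsub (Finset.finite_toSet _)
  rw [Set.ncard_coe_finset, Finset.card_product, Finset.card_range] at this
  -- There are at most `n * n` pairs, fewer than the `(n + 1) * (n + 1)` rounds.
  nlinarith

/-- The pair of the variables `4`, `5` is directly forced by table `2`. -/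
def forceCond : Ex :=
  .and (.tab 1 (.pair (.var 4) (.var 5))) (.sum (.add
    (.and (.tab 2 (.pair (.var 4) (.var 6))) (.tab 0 (.pair (.var 6) (.var 5))))
    (.and (.tab 2 (.pair (.var 6) (.var 5))) (.tab 0 (.pair (.var 6) (.var 4))))))

/-- Add the pair of the variables `4`, `5` to table `2` if it is directly forced. -/
def forceStore : Stmt :=
  .store 2 (.pair (.var 4) (.var 5))
    (.ite forceCond (.num 1) (.tab 2 (.pair (.var 4) (.var 5))))

/-- One round of adding forced pairs to table `2`, below four loops. -/
def forceRound : Stmt := .loop (.loop forceStore)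

/-- The pair of the variables `0`, `1` is nonadjacent and not oriented backwards. -/
def orientCond : Ex :=
  .and (.tab 1 (.pair (.var 0) (.var 1))) (.not (.tab 2 (.pair (.var 1) (.var 0))))

/-- Orient the pair of the variables `0`, `1` in table `2`. -/
def orientStore : Stmt :=
  .store 2 (.pair (.var 0) (.var 1))
    (.ite orientCond (.num 1) (.tab 2 (.pair (.var 0) (.var 1))))

/-- Orient the nonadjacent pairs in table `2`. -/
def orientStmt : Stmt := .loop (.loop (.seq orientStore (.loop (.loop forceRound))))

theorem iter_induction {α : Type*} {F : ℕ → α → α} {N : ℕ} {P : ℕ → α → Prop} {x : α}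
    (h0 : P 0 x) (hs : ∀ i < N, ∀ x, P i x → P (i + 1) (F i x)) : P N (iter F N x) := by
  have : ∀ k ≤ N, P k (iter F k x) := by
    intro k
    induction k with
    | zero => exact fun _ => h0
    | succ k ih => exact fun hk => hs k hk _ (ih (by omega))
  exact this N le_rfl

/-- The effect of storing a value that is `1` if `p` holds and the old entry otherwise. -/
theorem relOf_store_ite {w : List ℕ} {N v : ℕ} {ρ : ℕ → ℕ} {k : Fin 8} {a b c : Ex} {T : Tables}
    {x y : ℕ} (hx : x < N) (hy : y < N) (ha : a.eval w N T v ρ = x) (hb : b.eval w N T v ρ = y) :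
    (∀ j ≠ k, (Stmt.store k (.pair a b) (.ite c (.num 1) (.tab k (.pair a b)))).exec w N v ρ T j
      = T j) ∧
    ∀ i j, relOf N k ((Stmt.store k (.pair a b) (.ite c (.num 1) (.tab k (.pair a b)))).exec
      w N v ρ T) i j ↔ relOf N k T i j ∨ (i = x ∧ j = y ∧ c.eval w N T v ρ ≠ 0) := by
  refine ⟨fun j hj => Function.update_of_ne hj _ _, fun i j => ?_⟩
  simp only [relOf, Stmt.exec, Function.update_self, Ex.eval, Ex.eval_pair, ha, hb]
  by_cases h : i = x ∧ j = y
  · obtain ⟨rfl, rfl⟩ := h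
    rw [Function.update_self]
    split_ifs with h <;> simp [hx, hy, h]
  · have hne : i < N → j < N → i * N + j ≠ x * N + y := by
      intro hi hj he
      refine h ⟨?_, ?_⟩
      · simpa only [pair_div hj, pair_div hy] using congrArg (· / N) he
      · simpa only [pair_mod hj, pair_mod hy] using congrArg (· % N) he
    constructor
    · rintro ⟨hi, hj, h3⟩
      rw [Function.update_of_ne (hne hi hj)] at h3
      exact .inl ⟨hi, hj, h3⟩
    · rintro (⟨hi, hj, h3⟩ | h3)
      · exact ⟨hi, hj, by rwa [Function.update_of_ne (hne hi hj)]⟩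
      · exact absurd ⟨h3.1, h3.2.1⟩ h

theorem HasGraph.congr {A : ℕ → ℕ → Prop} {n : ℕ} {T T' : Tables} (h : HasGraph A n T)
    (h' : ∀ j ≠ 2, T' j = T j) : HasGraph A n T' := by
  intro a ha b hb
  rw [h' 0 (by decide), h' 1 (by decide)]
  exact h a ha b hb

/-- Table 2 is updated in place, so a pair added early in a round may force others in the same
round. The invariant therefore only brackets the result: it contains everything directly forced by
the old relation and lies in every closed relation containing the old one. -/
theorem forceRound_spec {A : ℕ → ℕ → Prop} {n : ℕ} {T : Tables} (w : List ℕ) (ρ : ℕ → ℕ)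
    (hT : HasGraph A n T) :
    HasGraph A n (forceRound.exec w (n + 1) 4 ρ T) ∧
      ForceStep A n (relOf (n + 1) 2 T) (relOf (n + 1) 2 (forceRound.exec w (n + 1) 4 ρ T)) := by
  set N := n + 1 with hN
  set M := relOf N 2 T with hM
  have hcond : ∀ a < N, ∀ b < N, ∀ T', HasGraph A n T' →
      (forceCond.eval w N T' 6 (Function.update (Function.update ρ 4 a) 5 b) ≠ 0 ↔
        NonAdj A n a b ∧ ∃ c, relOf N 2 T' a c ∧ A c b ∨ relOf N 2 T' c b ∧ A c a) := by
    intro a ha b hb T' hT'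
    rw [forceCond, Ex.eval_and, Ex.eval_sum]
    refine and_congr ?_ ?_
    · rw [Ex.eval_entry _ _ _ _ _ _ (by decide) (by decide), ← (hT' a ha b hb).2]
      simp [hN]
    · constructor
      · rintro ⟨c, hc, h⟩
        simp only [Ex.eval_add, Ex.eval_and] at h
        simp [Ex.eval_entry, Function.update] at h
        have h1 := (hT' c hc b hb).1
        have h2 := (hT' c hc a ha).1
        exact ⟨c, h.imp (fun h => ⟨⟨ha, hc, h.1⟩, h1.1 h.2⟩) fun h => ⟨⟨hc, hb, h.1⟩, h2.1 h.2⟩⟩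
      · rintro ⟨c, h⟩
        have hc : c < N := h.elim (fun h => h.1.2.1) fun h => h.1.1
        refine ⟨c, hc, ?_⟩
        simp only [Ex.eval_add, Ex.eval_and]
        have h1 := (hT' c hc b hb).1
        have h2 := (hT' c hc a ha).1
        simp [Ex.eval_entry, Function.update]
        exact h.imp (fun h => ⟨h.1.2.2, h1.2 h.2⟩) fun h => ⟨h.1.2.2, h2.2 h.2⟩
  have hstep : ∀ a < N, ∀ b < N, ∀ T', HasGraph A n T' → _ :=
    fun a ha b hb T' hT' => relOf_store_ite (w := w) (N := N) (v := 6)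
      (ρ := Function.update (Function.update ρ 4 a) 5 b) (k := 2) (a := .var 4) (b := .var 5)
      (c := forceCond) (T := T') ha hb (by simp [Ex.eval]) (by simp [Ex.eval])
  let I : ℕ → ℕ → Tables → Prop := fun i j T' =>
    HasGraph A n T' ∧ (∀ a b, M a b → relOf N 2 T' a b) ∧
    (∀ a b c, (a < i ∨ a = i ∧ b < j) → NonAdj A n a b → M a c ∧ A c b ∨ M c b ∧ A c a →
      relOf N 2 T' a b) ∧
    ∀ Q, ForceClosed A n Q → (∀ a b, M a b → Q a b) → ∀ a b, relOf N 2 T' a b → Q a b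
  have hI : I N 0 (forceRound.exec w N 4 ρ T) := by
    refine iter_induction (P := fun i T' => I i 0 T') ?_ fun i hi T' hT' => ?_
    · exact ⟨hT, fun _ _ h => h, fun a b c h => by omega, fun Q _ h => h⟩
    have : I i N (iter (fun j => Stmt.exec w N forceStore 6
        (Function.update (Function.update ρ 4 i) 5 j)) N T') := by
      refine iter_induction (P := I i) hT' fun j hj T' ⟨h1, h2, h3, h4⟩ => ?_
      obtain ⟨s1, s2⟩ := hstep i hi j hj T' h1
      change ∀ i' j', relOf N 2 (forceStore.exec w N 6 _ T') i' j' ↔ _ at s2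
      have hc := hcond i hi j hj T' h1
      refine ⟨h1.congr s1, fun a b h => (s2 a b).2 (.inl (h2 a b h)), fun a b c h h' h'' => ?_,
        fun Q hQ hMQ a b h => ?_⟩
      · rw [s2]
        by_cases hab : a = i ∧ b = j
        · obtain ⟨rfl, rfl⟩ := hab
          exact .inr ⟨rfl, rfl, hc.2 ⟨h', c, h''.imp (fun h => ⟨h2 _ _ h.1, h.2⟩)
            fun h => ⟨h2 _ _ h.1, h.2⟩⟩⟩
        · exact .inl (h3 a b c (by omega) h' h'')
      · rcases (s2 a b).1 h with h | ⟨rfl, rfl, h⟩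
        · exact h4 Q hQ hMQ a b h
        · obtain ⟨h5, c, h | h⟩ := hc.1 h
          · exact hQ.1 _ _ _ (h4 Q hQ hMQ _ _ h.1) h.2 h5
          · exact hQ.2 _ _ _ (h4 Q hQ hMQ _ _ h.1) h.2 h5
    refine ⟨this.1, this.2.1, fun a b c h h' => this.2.2.1 a b c ?_ h', this.2.2.2⟩
    have := h'.2.1
    omega
  exact ⟨hI.1, hI.2.1, fun a b c h => hI.2.2.1 a b c (.inl (by have := h.1; omega)) h, hI.2.2.2⟩

theorem forceRounds_spec {A : ℕ → ℕ → Prop} {n : ℕ} {T : Tables} (w : List ℕ) (ρ : ℕ → ℕ)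
    (hT : HasGraph A n T) :
    HasGraph A n ((Stmt.loop (.loop forceRound)).exec w (n + 1) 2 ρ T) ∧
      ForceSteps A n (relOf (n + 1) 2 T) ((n + 1) * (n + 1))
        (relOf (n + 1) 2 ((Stmt.loop (.loop forceRound)).exec w (n + 1) 2 ρ T)) := by
  refine iter_induction (P := fun i T' => HasGraph A n T' ∧
    ForceSteps A n (relOf (n + 1) 2 T) (i * (n + 1)) (relOf (n + 1) 2 T')) ⟨hT, ?_⟩ ?_
  · rw [zero_mul]; exact .zero
  · rintro i - T' ⟨h1, h2⟩
    have := iter_induction (N := n + 1) (P := fun j T'' => HasGraph A n T'' ∧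
      ForceSteps A n (relOf (n + 1) 2 T') j (relOf (n + 1) 2 T''))
      (F := fun j => forceRound.exec w (n + 1) 4 (Function.update (Function.update ρ 2 i) 3 j))
      (x := T') ⟨h1, .zero⟩ fun j _ T'' ⟨h1, h2⟩ =>
        ⟨(forceRound_spec w _ h1).1, h2.succ (forceRound_spec w _ h1).2⟩
    refine ⟨this.1, ?_⟩
    rw [add_mul, one_mul]
    exact h2.append this.2

/-- The invariant says that all nonadjacent pairs lexicographically before `(i, j)` are oriented in
one direction. This supplies the minimality of `u` that `IsPartialOrientation.extend` needs. -/
theorem orientStmt_spec {A : ℕ → ℕ → Prop} {n : ℕ} {R : ℕ → ℕ → Prop} {T : Tables} (w : List ℕ)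
    (ρ : ℕ → ℕ) (hR : IsIntervalOrder A n R) (hT : HasGraph A n T) (hT2 : T 2 = fun _ => 0) :
    HasGraph A n (orientStmt.exec w (n + 1) 0 ρ T) ∧
      IsPartialOrientation A n (relOf (n + 1) 2 (orientStmt.exec w (n + 1) 0 ρ T)) ∧
      ∀ x y, NonAdj A n x y → relOf (n + 1) 2 (orientStmt.exec w (n + 1) 0 ρ T) x y ∨
        relOf (n + 1) 2 (orientStmt.exec w (n + 1) 0 ρ T) y x := by
  set N := n + 1 with hN
  let I : ℕ → ℕ → Tables → Prop := fun i j T' => HasGraph A n T' ∧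
    IsPartialOrientation A n (relOf N 2 T') ∧ ∀ x y, (x < i ∨ x = i ∧ y < j) → NonAdj A n x y →
      relOf N 2 T' x y ∨ relOf N 2 T' y x
  have hI : I N 0 (orientStmt.exec w N 0 ρ T) := by
    refine iter_induction (P := fun i T' => I i 0 T') ?_ fun u hu T' hT' => ?_
    · have h0 : ∀ a b, ¬ relOf N 2 T a b := by simp [relOf, hT2]
      exact ⟨hT, ⟨fun a b h => absurd h (h0 a b), ⟨fun a b c h => absurd h (h0 a b),
        fun a b c h => absurd h (h0 a b)⟩, fun a b h => absurd h (h0 a b),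
        fun a b h => absurd h (h0 a b)⟩, fun a b h => by omega⟩
    have : I u N (iter (fun v => Stmt.exec w N (.seq orientStore
        (.loop (.loop forceRound))) 2 (Function.update (Function.update ρ 0 u) 1 v)) N T') := by
      refine iter_induction (P := I u) hT' fun v hv T' ⟨h1, h2, h3⟩ => ?_
      rw [Stmt.exec]
      set ρ' := Function.update (Function.update ρ 0 u) 1 v with hρ'
      obtain ⟨s1, s2⟩ := relOf_store_ite (w := w) (N := N) (v := 2) (ρ := ρ') (k := 2)
        (a := .var 0) (b := .var 1) (c := orientCond) (T := T') hu hv (by simp [Ex.eval, hρ'])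
        (by simp [Ex.eval, hρ'])
      change (∀ j ≠ 2, orientStore.exec w N 2 ρ' T' j = T' j) at s1
      change ∀ i j, relOf N 2 (orientStore.exec w N 2 ρ' T') i j ↔ _ at s2
      set T₁ := orientStore.exec w N 2 ρ' T'
      have hc : orientCond.eval w N T' 2 ρ' ≠ 0 ↔
          NonAdj A n u v ∧ ¬ relOf N 2 T' v u := by
        rw [orientCond, Ex.eval_and, Ex.eval_not, Ex.eval_entry _ _ _ _ _ _ (by decide) (by decide),
          Ex.eval_entry _ _ _ _ _ _ (by decide) (by decide), ← (h1 u hu v hv).2]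
        simp [hρ', relOf, hu, hv, Function.update]
        exact fun _ => Iff.rfl
      rw [hc] at s2
      obtain ⟨g1, g2⟩ := forceRounds_spec w ρ' (h1.congr s1)
      set T₂ := (Stmt.loop (.loop forceRound)).exec w N 2 ρ' T₁
      have hM1 : ∀ a b, relOf N 2 T₁ a b → NonAdj A n a b := by
        intro a b h
        rcases (s2 a b).1 h with h | ⟨rfl, rfl, h⟩
        exacts [h2.sub a b h, h.1]
      have hM2 := g2.closed hM1
      have hmono : ∀ a b, relOf N 2 T' a b → relOf N 2 T₂ a b :=
        fun a b h => g2.sub a b ((s2 a b).2 (.inl h))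
      refine ⟨g1, ?_, fun x y hxy h => ?_⟩
      · by_cases hnew : NonAdj A n u v ∧ ¬ relOf N 2 T' u v ∧ ¬ relOf N 2 T' v u
        · obtain ⟨n1, n2, n3⟩ := hnew
          refine h2.extend hR n1 n2 n3 (fun x hx y h => h3 x y (.inl hx) h) hM2
            (g2.sub_closed ?_ fun a b h => ?_)
          · have hQ := forceClosed_forces n1
            exact ⟨fun a b c h h' h'' => h.imp (fun h => h2.closed.1 _ _ _ h h' h'')
                fun h => hQ.1 _ _ _ h h' h'',
              fun a b c h h' h'' => h.imp (fun h => h2.closed.2 _ _ _ h h' h'')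
                fun h => hQ.2 _ _ _ h h' h''⟩
          · rcases (s2 a b).1 h with h | ⟨rfl, rfl, -⟩
            exacts [.inl h, .inr .refl]
        -- Here the assignment adds no pair, either because its condition fails or because the pair
        -- is already oriented; the relation is closed, so the forcing rounds add nothing.
        · have heq : relOf N 2 T₂ = relOf N 2 T' := by
            funext a b
            refine propext ⟨g2.sub_closed h2.closed (fun a b h => ?_) a b, hmono a b⟩
            rcases (s2 a b).1 h with h | ⟨rfl, rfl, h⟩
            · exact h
            · by_contra h'
              exact hnew ⟨h.1, h', h.2⟩
          rwa [heq]
      · by_cases hxy' : x = u ∧ y = v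
        · obtain ⟨rfl, rfl⟩ := hxy'
          by_cases h' : relOf N 2 T' y x
          · exact .inr (hmono _ _ h')
          · exact .inl (g2.sub _ _ ((s2 _ _).2 (.inr ⟨rfl, rfl, h, h'⟩)))
        · exact (h3 x y (by omega) h).imp (hmono _ _) (hmono _ _)
    refine ⟨this.1, this.2.1, fun a b h h' => this.2.2 a b ?_ h'⟩
    have := h'.2.1
    omega
  exact ⟨hI.1, hI.2.1, fun x y h => hI.2.2 x y (.inl (by have := h.1; omega)) h⟩

/-! ### Computing the interval model -/

/-- The entry of the adjacency matrix at the variables `0`, `1`, read from the input. -/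
def adjExpr : Ex :=
  .and (.and (.lt (.var 0) .size) (.lt (.var 1) .size))
    (.inp (.add (.add (.num 1) (.sub (.mulN (.var 0)) (.var 0))) (.var 1)))

/-- The variables `0`, `1` are different nonadjacent vertices. -/
def nonAdjExpr : Ex :=
  .and (.and (.lt (.var 0) .size) (.lt (.var 1) .size))
    (.and (.not (.eq (.var 0) (.var 1))) (.not (.tab 0 (.pair (.var 0) (.var 1)))))

/-- The number of predecessors of the variable `0`. -/
def leftExpr : Ex := .sum (.not (.not (.tab 2 (.pair (.var 1) (.var 0)))))

/-- The largest left end among the vertices that do not come after the variable `0`. -/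
def rightExpr : Ex :=
  .sub (.sum (.not (.not (.sum (.and (.lt (.var 2) .size)
    (.and (.not (.tab 2 (.pair (.var 0) (.var 2))))
      (.not (.lt (.tab 3 (.var 2)) (.var 1))))))))) (.num 1)

/-- Compute an interval model of the graph. -/
def modelStmt : Stmt :=
  .seq (.seq (.seq (.seq (fill2 0 0 adjExpr) (fill2 1 0 nonAdjExpr)) orientStmt)
    (fill1 3 0 leftExpr)) (fill1 4 0 rightExpr)

theorem Ex.eval_count (w : List ℕ) (N : ℕ) (T : Tables) (v : ℕ) (ρ : ℕ → ℕ) (a : Ex) :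
    (Ex.sum (.not (.not a))).eval w N T v ρ = ∑ i ∈ Finset.range N,
      if a.eval w N T (v + 1) (Function.update ρ v i) ≠ 0 then 1 else 0 := by
  refine Finset.sum_congr rfl fun i _ => ?_
  simp only [Ex.not, Ex.eval]; split_ifs <;> simp_all

/-- Loops run through `n + 1` values but there are only `n` vertices; the surplus index `n`
contributes nothing. -/
theorem sum_range_succ_ite {n : ℕ} {p q : ℕ → Prop} [DecidablePred p] [DecidablePred q]
    (hn : ¬ p n) (hq : ∀ i < n + 1, q i ↔ p i) :
    ∑ i ∈ Finset.range (n + 1), (if q i then 1 else 0) = ((Finset.range n).filter p).card := by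
  rw [Finset.sum_range_succ, if_neg (by rwa [hq n (by omega)]), add_zero, Finset.card_filter]
  exact Finset.sum_congr rfl fun i hi => if_congr (hq i (by have := Finset.mem_range.1 hi; omega))
    rfl rfl

theorem getD_encodeGraph_zero {n : ℕ} (G : SimpleGraph (Fin n)) : (encodeGraph G).getD 0 0 = n :=
  rfl

theorem getD_encodeGraph {n : ℕ} (G : SimpleGraph (Fin n)) {a b : ℕ} (ha : a < n) (hb : b < n) :
    (encodeGraph G).getD (1 + (a * n) + b) 0 ≠ 0 ↔ natAdj G a b := by
  have hlt : a * n + b < n * n := by nlinarith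
  rw [add_assoc, add_comm, encodeGraph, List.getD_cons_succ, List.getD_eq_getElem _ _ (by simpa)]
  simp only [List.getElem_ofFn]
  have h1 : (Fin.divNat ⟨a * n + b, hlt⟩ : Fin n) = ⟨a, ha⟩ := Fin.ext (pair_div hb)
  have h2 : (Fin.modNat ⟨a * n + b, hlt⟩ : Fin n) = ⟨b, hb⟩ := Fin.ext (pair_mod hb)
  rw [h1, h2]
  simp [natAdj, ha, hb]

theorem modelStmt_spec {n : ℕ} (G : SimpleGraph (Fin n)) {R : ℕ → ℕ → Prop} (ρ : ℕ → ℕ)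
    (hR : IsIntervalOrder (natAdj G) n R) :
    ∃ l r, IsIntervalModel (natAdj G) n l r ∧ ∀ x < n,
      modelStmt.exec (encodeGraph G) (n + 1) 0 ρ (fun _ _ => 0) 3 x = l x ∧
      modelStmt.exec (encodeGraph G) (n + 1) 0 ρ (fun _ _ => 0) 4 x = r x := by
  classical
  set N := n + 1 with hN
  set w := encodeGraph G with hw
  have hsize : ∀ (T : Tables) v ρ, Ex.size.eval w N T v ρ = n := fun _ _ _ => rfl
  simp only [modelStmt, Stmt.exec]
  obtain ⟨a1, a2⟩ := exec_fill2 (w := w) (N := N) (v := 0) (ρ := ρ) (k := 0) (e := adjExpr)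
    (g := fun a b => adjExpr.eval w N (fun _ _ => 0) 2 (setVars ρ 0 [a, b]))
    (T := fun _ _ => 0) (fun T' _ a _ b _ => rfl)
  have a3 : ∀ a < N, ∀ b < N,
      (fill2 0 0 adjExpr).exec w N 0 ρ (fun _ _ => 0) 0 (a * N + b) ≠ 0 ↔ natAdj G a b := by
    intro a ha b hb
    rw [a2 a ha b hb, adjExpr, Ex.eval_and, Ex.eval_and, Ex.eval_lt, Ex.eval_lt, hsize]
    simp only [Ex.eval, setVars]
    -- Rows of the input have length `n`, whereas only multiplication by `N = n + 1` is available;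
    -- `a * N - a` is the row offset `a * n`.
    simp only [Function.update, hN, mul_add, mul_one, Nat.add_sub_cancel]
    simp
    rw [← ne_eq]
    constructor
    · rintro ⟨⟨h1, h2⟩, h⟩
      exact (getD_encodeGraph G h1 h2).1 h
    · intro h
      obtain ⟨h1, h2, -⟩ := id h
      exact ⟨⟨h1, h2⟩, (getD_encodeGraph G h1 h2).2 h⟩
  set T₁ := (fill2 0 0 adjExpr).exec w N 0 ρ (fun _ _ => 0)
  obtain ⟨b1, b2⟩ := exec_fill2 (w := w) (N := N) (v := 0) (ρ := ρ) (k := 1) (e := nonAdjExpr)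
    (g := fun a b => nonAdjExpr.eval w N T₁ 2 (setVars ρ 0 [a, b])) (T := T₁)
    (fun T' hT' a _ b _ => by simp [nonAdjExpr, Ex.eval, Ex.and, Ex.not, Ex.lt, Ex.eq, Ex.size,
      Ex.pair, hT' 0 (by decide)])
  have b3 : ∀ a < N, ∀ b < N,
      (fill2 1 0 nonAdjExpr).exec w N 0 ρ T₁ 1 (a * N + b) ≠ 0 ↔ NonAdj (natAdj G) n a b := by
    intro a ha b hb
    rw [b2 a ha b hb, nonAdjExpr, Ex.eval_and, Ex.eval_and, Ex.eval_lt, Ex.eval_lt, hsize,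
      Ex.eval_and, Ex.eval_not, Ex.eval_not, Ex.eval_eq,
      Ex.eval_entry _ _ _ _ _ _ (by decide) (by decide)]
    simp only [Ex.eval, setVars]
    have := a3 a ha b hb
    simp [Function.update, NonAdj, ← this, and_assoc]
  set T₂ := (fill2 1 0 nonAdjExpr).exec w N 0 ρ T₁
  have hG : HasGraph (natAdj G) n T₂ := by
    intro a ha b hb
    exact ⟨by rw [b1 0 (by decide)]; exact a3 a ha b hb, b3 a ha b hb⟩
  obtain ⟨c1, c2, c3⟩ := orientStmt_spec w ρ hR hG (by
    rw [b1 2 (by decide), a1 2 (by decide)])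
  set T₃ := orientStmt.exec w N 0 ρ T₂
  set M := relOf N 2 T₃ with hM
  have hmodel := c2.isIntervalModel hR c3
  obtain ⟨d1, d2⟩ := exec_fill1 (w := w) (N := N) (v := 0) (ρ := ρ) (k := 3) (e := leftExpr)
    (g := leftEnd n M) (T := T₃) (by
      intro T' hT' a ha
      rw [leftExpr, Ex.eval_count, hN, sum_range_succ_ite (p := fun u => M u a), leftEnd]
      · intro h; exact absurd (c2.sub _ _ h).1 (lt_irrefl n)
      · intro i hi
        rw [Ex.eval_entry _ _ _ _ _ _ (by decide) (by decide), hT' 2 (by decide)]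
        simp only [setVars, Function.update]
        simp [hM, relOf, ← hN, ha]
        exact fun _ => hi)
  set T₄ := (fill1 3 0 leftExpr).exec w N 0 ρ T₃
  obtain ⟨e1, e2⟩ := exec_fill1 (w := w) (N := N) (v := 0) (ρ := ρ) (k := 4) (e := rightExpr)
    (g := rightEnd n M) (T := T₄) (by
      intro T' hT' a ha
      rw [rightExpr, Ex.eval, Ex.eval_count, rightEnd, Finset.card_filter]
      refine congrArg (· - 1) (Finset.sum_congr rfl fun p hp => if_congr ?_ rfl rfl)
      rw [Ex.eval_sum, Reaches]
      have hp' := Finset.mem_range.1 hp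
      have key : ∀ i < N, (Ex.and (.lt (.var 2) .size)
          (.and (.not (.tab 2 (.pair (.var 0) (.var 2))))
            (.not (.lt (.tab 3 (.var 2)) (.var 1))))).eval
          w N T' 3 (Function.update (Function.update (setVars ρ 0 [a]) 1 p) 2 i) ≠ 0 ↔
          i < n ∧ ¬ M a i ∧ p ≤ leftEnd n M i := by
        intro i hi
        rw [Ex.eval_and, Ex.eval_lt, hsize, Ex.eval_and, Ex.eval_not, Ex.eval_not, Ex.eval_lt,
          Ex.eval_entry _ _ _ _ _ _ (by decide) (by decide), hT' 2 (by decide), d1 2 (by decide)]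
        simp only [Ex.eval, hT' 3 (by decide), setVars, Function.update]
        simp [d2 i hi, hM, relOf, hi, ha]
      constructor
      · rintro ⟨i, hi, h⟩
        exact ⟨i, (key i hi).1 h⟩
      · rintro ⟨i, hi, h⟩
        exact ⟨i, by omega, (key i (by omega)).2 ⟨hi, h⟩⟩)
  refine ⟨_, _, hmodel, fun x hx => ⟨?_, e2 x (by omega)⟩⟩
  rw [e1 3 (by decide), d2 x (by omega)]

/-! ### Tabulating the dynamic program -/

/-- The left end of the interval of the variable `1`. -/
def lE : Ex := .tab 3 (.var 1)

/-- The right end of the interval of the variable `1`. -/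
def rE : Ex := .tab 4 (.var 1)

/-- The second component of the next state of a color at an unlabeled vertex. -/
def emptyExpr (L E : Ex) : Ex := .ite (.sub L rE) (.max E (.add lE (.num 1))) E

/-- The first component of the next state of a color at a vertex of that color. -/
def coloredFst (L : Ex) : Ex := .min L lE

/-- The second component of the next state of a color at a vertex of that color. -/
def coloredSnd (E : Ex) : Ex := .ite (.sub E (.add rE (.num 1))) E (.num 0)

/-- The value of a state in table `5`. -/
def valueExpr (a b c d : Ex) : Ex := .tab 5 (.quad a b c d)

/-- The value of the state in the variables `2`, …, `5` after the vertex in variable `1` has been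
put in front, if its right end is the variable `0`. -/
def dpExpr : Ex :=
  .ite (.and (.lt (.var 1) .size) (.eq rE (.var 0)))
    (.min
      (.min
        (valueExpr (.var 2) (emptyExpr (.var 2) (.var 3)) (.var 4) (emptyExpr (.var 4) (.var 5)))
        (.add (.num 1) (valueExpr (coloredFst (.var 2)) (coloredSnd (.var 3)) (.var 4) (.var 5))))
      (.min
        (.add (.num 1) (valueExpr (.var 2) (.var 3) (coloredFst (.var 4)) (coloredSnd (.var 5))))
        (.add (.num 2) (valueExpr (coloredFst (.var 2)) (coloredSnd (.var 3)) (coloredFst (.var 4))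
          (coloredSnd (.var 5))))))
    (valueExpr (.var 2) (.var 3) (.var 4) (.var 5))

/-- Table `5` for the empty list of vertices. -/
def initStmt : Stmt :=
  fill4 5 0 (.ite (.add (.var 1) (.var 3)) (.add .len .len) (.num 0))

/-- The dynamic program. -/
def dpStmt : Stmt :=
  .loop (.loop (.seq (fill4 6 2 dpExpr)
    (fill4 5 2 (.tab 6 (.quad (.var 2) (.var 3) (.var 4) (.var 5))))))

/-- Table `5` holds the values of all states. -/
def HasValues (n : ℕ) (l r : ℕ → ℕ) (xs : List ℕ) (t : ℕ → ℕ) : Prop :=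
  ∀ a < n + 1, ∀ b < n + 1, ∀ c < n + 1, ∀ d < n + 1,
    t (((a * (n + 1) + b) * (n + 1) + c) * (n + 1) + d) =
      SweepState.value (2 * (n + 1)) l r xs ((a, b), (c, d))

theorem initStmt_spec (w : List ℕ) (n : ℕ) (ρ : ℕ → ℕ) (T : Tables) (l r : ℕ → ℕ) :
    (∀ j ≠ 5, initStmt.exec w (n + 1) 0 ρ T j = T j) ∧
      HasValues n l r [] (initStmt.exec w (n + 1) 0 ρ T 5) := by
  refine exec_fill4 fun T' _ a _ b _ c _ d _ => ?_
  simp [Ex.eval, setVars, Function.update, SweepState.value, SweepState.penalty, two_mul]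

/-- The four alternatives are the four labels of the new vertex. Each looks up the value for `xs` at
the successor state, whose components must stay within the table. -/
theorem dpExpr_spec {n : ℕ} {l r : ℕ → ℕ} {xs : List ℕ} {T : Tables} (w : List ℕ) (ρ : ℕ → ℕ)
    (hT : HasValues n l r xs (T 5)) {p v a b c d : ℕ}
    (hv : v < n → T 3 v = l v ∧ T 4 v = r v ∧ l v < n)
    (ha : a < n + 1) (hb : b < n + 1) (hc : c < n + 1) (hd : d < n + 1) :
    dpExpr.eval w (n + 1) T 6 (setVars ρ 0 [p, v, a, b, c, d]) =
      if v < n ∧ r v = p then SweepState.value (2 * (n + 1)) l r (v :: xs) ((a, b), (c, d))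
      else SweepState.value (2 * (n + 1)) l r xs ((a, b), (c, d)) := by
  set ρ' := setVars ρ 0 [p, v, a, b, c, d] with hρ'
  have v0 : (Ex.var 0).eval w (n + 1) T 6 ρ' = p := by simp [Ex.eval, hρ', setVars, Function.update]
  have v1 : (Ex.var 1).eval w (n + 1) T 6 ρ' = v := by simp [Ex.eval, hρ', setVars, Function.update]
  have v2 : (Ex.var 2).eval w (n + 1) T 6 ρ' = a := by simp [Ex.eval, hρ', setVars, Function.update]
  have v3 : (Ex.var 3).eval w (n + 1) T 6 ρ' = b := by simp [Ex.eval, hρ', setVars, Function.update]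
  have v4 : (Ex.var 4).eval w (n + 1) T 6 ρ' = c := by simp [Ex.eval, hρ', setVars, Function.update]
  have v5 : (Ex.var 5).eval w (n + 1) T 6 ρ' = d := by simp [Ex.eval, hρ', setVars]
  have hval : ∀ {x y z u : Ex} {s t : ColorState}, x.eval w (n + 1) T 6 ρ' = s.1 →
      y.eval w (n + 1) T 6 ρ' = s.2 → z.eval w (n + 1) T 6 ρ' = t.1 →
      u.eval w (n + 1) T 6 ρ' = t.2 → s.1 < n + 1 ∧ s.2 < n + 1 → t.1 < n + 1 ∧ t.2 < n + 1 →
      (valueExpr x y z u).eval w (n + 1) T 6 ρ' =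
        SweepState.value (2 * (n + 1)) l r xs (s, t) := by
    intro x y z u s t h1 h2 h3 h4 h5 h6
    rw [← hT _ h5.1 _ h5.2 _ h6.1 _ h6.2, ← h1, ← h2, ← h3, ← h4]
    rfl
  have hsize : Ex.size.eval w (n + 1) T 6 ρ' = n := rfl
  rw [dpExpr, Ex.eval_ite]
  have hcond : (Ex.and (.lt (.var 1) .size) (.eq rE (.var 0))).eval w (n + 1) T 6 ρ' ≠ 0 ↔
      v < n ∧ r v = p := by
    rw [Ex.eval_and, Ex.eval_lt, Ex.eval_eq, hsize, v1, v0, rE, Ex.eval, v1]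
    exact and_congr_right fun h => by rw [(hv h).2.1]
  rw [if_congr hcond rfl rfl]
  split_ifs with h
  · obtain ⟨hl, hr, hln⟩ := hv h.1
    have hlE : lE.eval w (n + 1) T 6 ρ' = l v := by rw [lE, Ex.eval, v1, hl]
    have hrE : rE.eval w (n + 1) T 6 ρ' = r v := by rw [rE, Ex.eval, v1, hr]
    have e1 : ∀ {x y : Ex} {s : ColorState} (i : Fin 2), x.eval w (n + 1) T 6 ρ' = s.1 →
        y.eval w (n + 1) T 6 ρ' = s.2 → s.1 = (s.next (l v) (r v) ∅ i).1 ∧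
          (emptyExpr x y).eval w (n + 1) T 6 ρ' = (s.next (l v) (r v) ∅ i).2 := by
      intro x y s i h1 h2
      simp only [emptyExpr, Ex.eval, hrE, hlE, h1, h2, ColorState.next, if_true, Ex.eval_max,
        Nat.sub_eq_zero_iff_le]
      split_ifs <;> exact ⟨rfl, rfl⟩
    have e2 : ∀ {x y : Ex} {s : ColorState} {S : Finset (Fin 2)} {i : Fin 2}, i ∈ S →
        x.eval w (n + 1) T 6 ρ' = s.1 → y.eval w (n + 1) T 6 ρ' = s.2 →
          (coloredFst x).eval w (n + 1) T 6 ρ' = (s.next (l v) (r v) S i).1 ∧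
          (coloredSnd y).eval w (n + 1) T 6 ρ' = (s.next (l v) (r v) S i).2 := by
      intro x y s S i hi h1 h2
      have hS : S ≠ ∅ := by rintro rfl; simp at hi
      simp only [coloredFst, coloredSnd, Ex.eval, hrE, hlE, h1, h2, ColorState.next, if_neg hS,
        if_pos hi, Ex.eval_min, Nat.sub_eq_zero_iff_le, and_self]
    have e3 : ∀ {s : ColorState} {S : Finset (Fin 2)} {i : Fin 2}, S ≠ ∅ → i ∉ S →
        s.next (l v) (r v) S i = s := fun h1 h2 => by
      rw [ColorState.next, if_neg h1, if_neg h2]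
    -- From `l v < n` follows `l v + 1 ≤ n`, so states never leave the range `0, …, n`; this is why
    -- tables have side `n + 1`.
    have bd : ∀ {s : ColorState} (S : Finset (Fin 2)) (i : Fin 2), s.1 < n + 1 ∧ s.2 < n + 1 →
        (s.next (l v) (r v) S i).1 < n + 1 ∧ (s.next (l v) (r v) S i).2 < n + 1 := by
      intro s S i hs
      unfold ColorState.next
      split_ifs <;> (try dsimp only) <;> omega
    rw [SweepState.value, Ex.eval_min, Ex.eval_min, Ex.eval_min]
    simp only [Ex.eval, SweepState.next]
    have s1 : ((a, b) : ColorState).1 < n + 1 ∧ ((a, b) : ColorState).2 < n + 1 := ⟨ha, hb⟩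
    have s2 : ((c, d) : ColorState).1 < n + 1 ∧ ((c, d) : ColorState).2 < n + 1 := ⟨hc, hd⟩
    congr 1
    · congr 1
      · have h1 := e1 (s := (a, b)) 0 v2 v3
        have h2 := e1 (s := (c, d)) 1 v4 v5
        exact hval (v2.trans h1.1) h1.2 (v4.trans h2.1) h2.2 (bd _ _ s1) (bd _ _ s2)
      · have h1 := e2 (s := (a, b)) (S := {0}) (i := 0) (by decide) v2 v3
        rw [e3 (s := (c, d)) (S := {0}) (i := 1) (by decide) (by decide)]
        exact congrArg (1 + ·) (hval h1.1 h1.2 v4 v5 (bd _ _ s1) s2)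
    · congr 1
      · have h2 := e2 (s := (c, d)) (S := {1}) (i := 1) (by decide) v4 v5
        rw [e3 (s := (a, b)) (S := {1}) (i := 0) (by decide) (by decide)]
        exact congrArg (1 + ·) (hval v2 v3 h2.1 h2.2 s1 (bd _ _ s2))
      · have h1 := e2 (s := (a, b)) (S := {0, 1}) (i := 0) (by decide) v2 v3
        have h2 := e2 (s := (c, d)) (S := {0, 1}) (i := 1) (by decide) v4 v5
        exact congrArg (2 + ·) (hval h1.1 h1.2 h2.1 h2.2 (bd _ _ s1) (bd _ _ s2))
  · exact hval (s := (a, b)) (t := (c, d)) v2 v3 v4 v5 ⟨ha, hb⟩ ⟨hc, hd⟩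

/-- The two outer loops act as a bucket sort: vertices are put in front of the list by increasing
right end `p`, with ties broken by number, so the final list has decreasing right ends. Table 6 is a
scratch copy, since an update needs old entries of table 5 at other states. -/
theorem dpStmt_spec {A : ℕ → ℕ → Prop} {n : ℕ} {l r : ℕ → ℕ} {T : Tables} (w : List ℕ) (ρ : ℕ → ℕ)
    (hm : IsIntervalModel A n l r) (hT : ∀ x < n, T 3 x = l x ∧ T 4 x = r x)
    (hT5 : HasValues n l r [] (T 5)) :
    ∃ xs : List ℕ, xs.Nodup ∧ (xs.Pairwise fun x y => r y ≤ r x) ∧ (∀ x, x ∈ xs ↔ x < n) ∧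
      HasValues n l r xs (dpStmt.exec w (n + 1) 0 ρ T 5) := by
  set N := n + 1 with hN
  let I : ℕ → ℕ → Tables → Prop := fun i j T' => (∀ x < n, T' 3 x = l x ∧ T' 4 x = r x) ∧
    ∃ xs : List ℕ, xs.Nodup ∧ (xs.Pairwise fun x y => r y ≤ r x) ∧
      (∀ x, x ∈ xs ↔ x < n ∧ (r x < i ∨ r x = i ∧ x < j)) ∧ HasValues n l r xs (T' 5)
  have hI : I N 0 (dpStmt.exec w N 0 ρ T) := by
    refine iter_induction (P := fun i T' => I i 0 T') ?_ fun p hp T' hT' => ?_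
    · exact ⟨hT, [], by simp, by simp, fun x => by simp, hT5⟩
    have : I p N (iter (fun v => Stmt.exec w N (.seq (fill4 6 2 dpExpr)
        (fill4 5 2 (.tab 6 (.quad (.var 2) (.var 3) (.var 4) (.var 5))))) 2
        (Function.update (Function.update ρ 0 p) 1 v)) N T') := by
      refine iter_induction (P := I p) hT' fun v hv T' ⟨h1, xs, h2, h3, h4, h5⟩ => ?_
      rw [Stmt.exec]
      set ρ' := Function.update (Function.update ρ 0 p) 1 v with hρ'
      obtain ⟨a1, a2⟩ := exec_fill4 (w := w) (N := N) (v := 2) (ρ := ρ') (k := 6) (e := dpExpr)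
        (g := fun a b c d => if v < n ∧ r v = p then
          SweepState.value (2 * (n + 1)) l r (v :: xs) ((a, b), (c, d))
          else SweepState.value (2 * (n + 1)) l r xs ((a, b), (c, d))) (T := T') (by
        intro T'' hT'' a ha b hb c hc d hd
        refine dpExpr_spec w ρ (by rwa [hT'' 5 (by decide)]) (fun hv => ?_) ha hb hc hd
        rw [hT'' 3 (by decide), hT'' 4 (by decide)]
        exact ⟨(h1 v hv).1, (h1 v hv).2, (hm.le v hv).trans_lt (hm.lt v hv)⟩)
      set T₁ := (fill4 6 2 dpExpr).exec w N 2 ρ' T'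
      obtain ⟨b1, b2⟩ := exec_fill4 (w := w) (N := N) (v := 2) (ρ := ρ') (k := 5)
        (e := .tab 6 (.quad (.var 2) (.var 3) (.var 4) (.var 5)))
        (g := fun a b c d => T₁ 6 (((a * N + b) * N + c) * N + d)) (T := T₁) (by
        intro T'' hT'' a ha b hb c hc d hd
        simp [Ex.eval, Ex.quad, Ex.pair, setVars, Function.update, hT'' 6 (by decide)])
      refine ⟨fun x hx => ?_, ?_⟩
      · rw [b1 3 (by decide), b1 4 (by decide), a1 3 (by decide), a1 4 (by decide)]
        exact h1 x hx
      by_cases hc : v < n ∧ r v = p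
      · refine ⟨v :: xs, List.nodup_cons.2 ⟨fun h => ?_, h2⟩,
          List.pairwise_cons.2 ⟨fun x hx => ?_, h3⟩,
          fun x => ?_, fun a ha b hb c hc' d hd => ?_⟩
        · have := (h4 v).1 h; omega
        · have := (h4 x).1 hx; omega
        · rw [List.mem_cons, h4]
          constructor
          · rintro (rfl | h)
            · exact ⟨hc.1, .inr ⟨hc.2, by omega⟩⟩
            · exact ⟨h.1, by omega⟩
          · rintro ⟨h, h'⟩
            by_cases hxv : x = v
            · exact .inl hxv
            · exact .inr ⟨h, by omega⟩
        · exact (b2 a ha b hb c hc' d hd).trans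
            ((a2 a ha b hb c hc' d hd).trans (if_pos hc))
      · refine ⟨xs, h2, h3, fun x => ?_, fun a ha b hb c hc' d hd => ?_⟩
        · rw [h4]
          refine and_congr_right fun hx => ⟨by omega, fun h => ?_⟩
          by_cases hxv : x = v
          · subst hxv; omega
          · omega
        · exact (b2 a ha b hb c hc' d hd).trans
            ((a2 a ha b hb c hc' d hd).trans (if_neg hc))
    obtain ⟨h1, xs, h2, h3, h4, h5⟩ := this
    exact ⟨h1, xs, h2, h3, fun x => by rw [h4]; exact and_congr_right fun hx => by omega, h5⟩
  obtain ⟨-, xs, h2, h3, h4, h5⟩ := hI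
  exact ⟨xs, h2, h3, fun x => by
    rw [h4]; exact and_iff_left_of_imp fun hx => .inl (by have := hm.lt x hx; omega), h5⟩

/-! ### Assembling the algorithm -/

/-- The order of disjoint intervals of an interval graph. -/
theorem IsIntervalGraph.exists_isIntervalOrder {n : ℕ} {G : SimpleGraph (Fin n)}
    (hG : IsIntervalGraph G) : ∃ R, IsIntervalOrder (natAdj G) n R := by
  obtain ⟨l, r, hlr, hadj⟩ := hG
  have hadj' : ∀ u v, u ≠ v → (G.Adj u v ↔ l u ≤ r v ∧ l v ≤ r u) := by
    intro u v huv
    rw [hadj u v huv, Set.Icc_inter_Icc, Set.nonempty_Icc, sup_le_iff, le_inf_iff, le_inf_iff]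
    have := hlr u
    have := hlr v
    tauto
  have hnon : ∀ {a b : ℕ}, NonAdj (natAdj G) n a b → ∃ (ha : a < n) (hb : b < n),
      r ⟨a, ha⟩ < l ⟨b, hb⟩ ∨ r ⟨b, hb⟩ < l ⟨a, ha⟩ := by
    rintro a b ⟨ha, hb, hne, h⟩
    refine ⟨ha, hb, ?_⟩
    by_contra! h'
    exact h ⟨ha, hb, (hadj' _ _ fun h => hne (congrArg Fin.val h)).2 ⟨h'.2, h'.1⟩⟩
  have hA : ∀ {a b : ℕ}, natAdj G a b → ∃ (ha : a < n) (hb : b < n),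
      l ⟨a, ha⟩ ≤ r ⟨b, hb⟩ ∧ l ⟨b, hb⟩ ≤ r ⟨a, ha⟩ :=
    fun ⟨ha, hb, h⟩ => ⟨ha, hb, (hadj' _ _ h.ne).1 h⟩
  refine ⟨fun a b => ∃ (ha : a < n) (hb : b < n), r ⟨a, ha⟩ < l ⟨b, hb⟩,
    fun a b ⟨ha, hb, h⟩ => ⟨hb, ha, h.symm⟩, fun a b ⟨ha, hb, _⟩ => ⟨ha, hb⟩, ⟨?_, ?_⟩, ?_, ?_, ?_⟩
  · rintro a b c ⟨ha, hb, h1⟩ h2 h3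
    obtain ⟨_, hc, h2⟩ := hA h2
    obtain ⟨_, _, h3 | h3⟩ := hnon h3
    · exact ⟨ha, hc, h3⟩
    · linarith [hlr ⟨a, ha⟩]
  · rintro a b c ⟨ha, hb, h1⟩ h2 h3
    obtain ⟨_, hc, h2⟩ := hA h2
    obtain ⟨_, _, h3 | h3⟩ := hnon h3
    · exact ⟨hc, hb, h3⟩
    · linarith [hlr ⟨b, hb⟩]
  · intro a b
    constructor
    · intro h
      obtain ⟨ha, hb, h | h⟩ := hnon h
      exacts [.inl ⟨ha, hb, h⟩, .inr ⟨hb, ha, h⟩]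
    · have key : ∀ {a b : ℕ} (ha : a < n) (hb : b < n), r ⟨a, ha⟩ < l ⟨b, hb⟩ →
          a ≠ b ∧ ¬ natAdj G a b := by
        intro a b ha hb h
        constructor
        · rintro rfl
          exact absurd (hlr ⟨a, ha⟩) (not_le.2 h)
        · intro h'
          obtain ⟨_, _, h'⟩ := hA h'
          linarith
      rintro (⟨ha, hb, h⟩ | ⟨hb, ha, h⟩)
      · exact ⟨ha, hb, key ha hb h⟩
      · exact ⟨ha, hb, (key hb ha h).1.symm, fun ⟨h1, h2, h3⟩ => (key hb ha h).2 ⟨h2, h1, h3.symm⟩⟩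
  · rintro a b ⟨ha, hb, h⟩ ⟨_, _, h'⟩
    linarith [hlr ⟨a, ha⟩, hlr ⟨b, hb⟩]
  · intro a b c d h1 h2 h3 h4 h5 h6
    obtain ⟨ha, hb, h1⟩ := hA h1
    obtain ⟨_, hc, h2⟩ := hA h2
    obtain ⟨_, hd, h3⟩ := hA h3
    obtain ⟨_, _, h4⟩ := hA h4
    obtain ⟨_, _, h5⟩ := hnon h5
    obtain ⟨_, _, h6⟩ := hnon h6
    rcases h5 with h5 | h5 <;> rcases h6 with h6 | h6 <;> linarith

/-- The program before the output. -/
def mainStmt : Stmt := .seq (.seq modelStmt initStmt) dpStmt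

/-- The output of the program. -/
def outputExpr : Ex := valueExpr .size (.num 0) .size (.num 0)

theorem mainTheorem1 :
    ∃ (P : RAMProgram) (C : ℕ), ∀ (n : ℕ) (G : SimpleGraph (Fin n)), IsIntervalGraph G →
      P.OutputsWithin (encodeGraph G) (rainbowDominationNumber 2 G) (C * (n + 1) ^ 9) := by
  -- The deepest nesting is in the orientation: two loops over pairs, two over rounds, two over
  -- candidates, one sum, and one multiplication in an index. This is depth 8, and the dynamic
  -- program has depth 7, so 9 suffices.
  obtain ⟨P, C, h⟩ := exists_ramProgram mainStmt outputExpr (d := 9) (by decide) (by decide)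
  refine ⟨P, C, fun n G hG => ?_⟩
  have := h (encodeGraph G)
  rw [getD_encodeGraph_zero] at this
  obtain ⟨R, hR⟩ := hG.exists_isIntervalOrder
  obtain ⟨l, r, hm, h1⟩ := modelStmt_spec G (fun _ => 0) hR
  set T₁ := modelStmt.exec (encodeGraph G) (n + 1) 0 (fun _ => 0) fun _ _ => 0 with hT₁
  obtain ⟨h2, h3⟩ := initStmt_spec (encodeGraph G) n (fun _ => 0) T₁ l r
  obtain ⟨xs, h4, h5, h6, h7⟩ := dpStmt_spec (encodeGraph G) (fun _ => 0) hm (fun x hx => by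
    rw [h2 3 (by decide), h2 4 (by decide)]
    exact h1 x hx) h3
  have hval := SweepState.value_eq_rainbowDominationNumber G hm h5 h4 h6
    (big := 2 * (n + 1)) (by omega)
  -- The output is the table entry at the initial state `((n, 0), (n, 0))`: no colored vertex and no
  -- lacking vertex.
  rw [← hval, ← h7 n (by omega) 0 (by omega) n (by omega) 0 (by omega)]
  exact this
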